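/- All symmetric monoidal categories below are small and strict (the associators and unitors are identities), and symmetric monoidal functors are strict (they preserve $\otimes$, the unit object $I$ and the symmetries $\sigma$ on the nose). Let $\mathbf{SMC}$ be the category of symmetric monoidal categories and symmetric monoidal functors. Composition is written in diagrammatic order. A symmetric monoidal category $C$ is *traced* if it is equipped with operators $\mathsf{tr}_S : C(S\otimes X, S\otimes Y)\to C(X,Y)$, for all objects $S,X,Y$, such that, for all suitably typed $f,g,u,v$: $\mathsf{tr}_S((\mathrm{id}\otimes u);f;(\mathrm{id}\otimes v)) = u;\mathsf{tr}_S f;v$ (tightening); $\mathsf{tr}_S(f\otimes g)=\mathsf{tr}_S f\otimes g$ (strength); $\mathsf{tr}_T\mathsf{tr}_S f=\mathsf{tr}_{S\otimes T}f$ (joining); $\mathsf{tr}_I f=f$ (vanishing); $\mathsf{tr}_T(f;(u\otimes \mathrm{id}))=\mathsf{tr}_S((u\otimes\mathrm{id});f)$ (sliding); $\mathsf{tr}_S\,\sigma_{S,S}=\mathrm{id}_S$ (yanking). Let $\mathbf{TSMC}$ be the category of traced monoidal categories, with the symmetric monoidal functors $F$ such that $F(\mathsf{tr}_S f)=\mathsf{tr}_{FS}(Ff)$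 as morphisms. A traced monoidal category is *uniformly traced* if, for all $f:S\otimes X\to S\otimes Y$, $g:T\otimes X\to T\otimes Y$ and $r:S\to T$, the equality $f;(r\otimes\mathrm{id}_Y)=(r\otimes\mathrm{id}_X);g$ implies $\mathsf{tr}_S f=\mathsf{tr}_T g$. Let $\mathbf{UTSMC}$ be the full subcategory of $\mathbf{TSMC}$ on the uniformly traced monoidal categories. **The functor $\mathsf{freeTr}:\mathbf{SMC}\to\mathbf{TSMC}$.** The objects of $\mathsf{freeTr}(C)$ are those of $C$. Morphisms $X\to Y$ are pairs $(f\mid S)$ of an object $S$ and a morphism $f:S\otimes X\to S\otimes Y$ of $C$, modulo the least congruence (equivalence relation closed under the three operations below) that contains *sliding*, $(f;(u\otimes\mathrm{id}_Y)\mid T)\sim((u\otimes\mathrm{id}_X);f\mid S)$ for $f:T\otimes X\to S\otimes Y$ and $u:S\to T$, and *yanking*, $(\sigma_{S,S}\mid S)\sim(\mathrm{id}_S\mid I)$. The operations are, for $f:S\otimes X\to S\otimes Y$: $(f\mid S);(g\mid T) = \big((\sigma_{S,T}\otimes\mathrm{id}_X);(\mathrm{id}_T\otimes f);(\sigma_{T,S}\otimes\mathrm{id}_Y);(\mathrm{id}_S\otimes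 g)\,\big|\,S\otimes T\big)$ for $g:T\otimes Y\to T\otimes Z$; $(f\mid S)\otimes(g\mid T) = \big((\mathrm{id}_S\otimes\sigma_{T,X}\otimes\mathrm{id}_Z);(f\otimes g);(\mathrm{id}_S\otimes\sigma_{Y,T}\otimes\mathrm{id}_W)\,\big|\,S\otimes T\big)$ for $g:T\otimes Z\to T\otimes W$; $\mathsf{tr}_T(f\mid S)=(f\mid S\otimes T)$ for $f:S\otimes T\otimes X\to S\otimes T\otimes Y$. Identities and symmetries are $(\mathrm{id}\mid I)$ and $(\sigma\mid I)$. A functor $F$ is sent to $X\mapsto FX$, $(f\mid S)\mapsto(Ff\mid FS)$. **The functor $\mathsf{Unif}:\mathbf{TSMC}\to\mathbf{UTSMC}$.** $\mathsf{Unif}(C)$ is the quotient of $C$ by $\approx$, the least equivalence relation on parallel morphisms that is closed under $;$ and $\otimes$ and under the rule: if $u\approx v$, for $u,v:S\to T$, and $f;(u\otimes\mathrm{id})\approx(v\otimes\mathrm{id});g$, then $\mathsf{tr}_S f\approx\mathsf{tr}_T g$. A morphism $F$ is sent to $X\mapsto FX$, $[f]\mapsto[Ff]$. **Theorem.** Let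 $\mathsf{UTr}:\mathbf{SMC}\to\mathbf{UTSMC}$ be the composite of $\mathsf{freeTr}$ and $\mathsf{Unif}$. Then $\mathsf{UTr}$ is left adjoint to the forgetful functor $\mathbf{UTSMC}\to\mathbf{SMC}$. -/

import Mathlib

open CategoryTheory MonoidalCategory

set_option linter.unusedSectionVars false
set_option linter.unusedSimpArgs false
set_option linter.checkUnivs false
universe v u

namespace UniformTrace

section Raw

variable {C : Type u} [Category.{v} C] [MonoidalCategory C] [SymmetricCategory C]

/-- The symmetry exchanging the first two of three factors. -/
def sw (S T X : C) : S ⊗ (T ⊗ X) ⟶ T ⊗ (S ⊗ X) :=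
  (α_ S T X).inv ≫ (β_ S T).hom ▷ X ≫ (α_ T S X).hom

lemma sw_sw (S T X : C) : sw S T X ≫ sw T S X = 𝟙 _ := by
  simp [sw, ← comp_whiskerRight_assoc]

lemma sw_sw_assoc (S T X : C) {Z : C} (h : S ⊗ (T ⊗ X) ⟶ Z) :
    sw S T X ≫ sw T S X ≫ h = h := by
  rw [← Category.assoc, sw_sw, Category.id_comp]

lemma sw_nat3 (S T : C) {X Y : C} (f : X ⟶ Y) :
    S ◁ T ◁ f ≫ sw S T Y = sw S T X ≫ T ◁ S ◁ f := by
  simp only [sw, Category.assoc]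
  rw [associator_inv_naturality_right_assoc, whisker_exchange_assoc,
    associator_naturality_right]

lemma sw_nat1 {S S' : C} (u : S ⟶ S') (T X : C) :
    u ▷ (T ⊗ X) ≫ sw S' T X = sw S T X ≫ T ◁ (u ▷ X) := by
  simp only [sw, Category.assoc]
  rw [associator_inv_naturality_left_assoc, ← comp_whiskerRight_assoc,
    BraidedCategory.braiding_naturality_left, comp_whiskerRight_assoc, associator_naturality_middle]

lemma sw_nat2 (S : C) {T T' : C} (u : T ⟶ T') (X : C) :
    S ◁ (u ▷ X) ≫ sw S T' X = sw S T X ≫ u ▷ (S ⊗ X) := by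
  simp only [sw, Category.assoc]
  rw [associator_inv_naturality_middle_assoc, ← comp_whiskerRight_assoc,
    BraidedCategory.braiding_naturality_right, comp_whiskerRight_assoc, associator_naturality_left]

lemma sw_tensor_left (S T U X : C) :
    (α_ S T (U ⊗ X)).hom ≫ S ◁ sw T U X ≫ sw S U (T ⊗ X) =
      sw (S ⊗ T) U X ≫ U ◁ (α_ S T X).hom := by
  simp [sw]

lemma sw_tensor_right (S T U X : C) :
    sw S (T ⊗ U) X ≫ (α_ T U (S ⊗ X)).hom =
      S ◁ (α_ T U X).hom ≫ sw S T (U ⊗ X) ≫ T ◁ sw S U X := by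
  simp [sw]

lemma sw_whisker (S T X Z : C) :
    sw S T X ▷ Z ≫ (α_ T (S ⊗ X) Z).hom ≫ T ◁ (α_ S X Z).hom =
      (α_ S (T ⊗ X) Z).hom ≫ S ◁ (α_ T X Z).hom ≫ sw S T (X ⊗ Z) := by
  simp [sw]

lemma sw_unit_left (T X : C) :
    sw (𝟙_ C) T X = (λ_ (T ⊗ X)).hom ≫ T ◁ (λ_ X).inv := by
  simp [sw]

lemma sw_unit_right (S X : C) :
    sw S (𝟙_ C) X = S ◁ (λ_ X).hom ≫ (λ_ (S ⊗ X)).inv := by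
  simp [sw]

/-- A morphism `f : S ⊗ X ⟶ S ⊗ Y` tensored on the left with `Z`, the state wire `S` being moved
across `Z` by symmetries. -/
def wl (Z : C) {S X Y : C} (f : S ⊗ X ⟶ S ⊗ Y) : S ⊗ (Z ⊗ X) ⟶ S ⊗ (Z ⊗ Y) :=
  sw S Z X ≫ Z ◁ f ≫ sw Z S Y

/-- A morphism `f : S ⊗ X ⟶ S ⊗ Y` tensored on the right with `Z`. -/
def wr {S X Y : C} (f : S ⊗ X ⟶ S ⊗ Y) (Z : C) : S ⊗ (X ⊗ Z) ⟶ S ⊗ (Y ⊗ Z) :=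
  (α_ S X Z).inv ≫ f ▷ Z ≫ (α_ S Y Z).hom

lemma wl_comp (Z : C) {S X Y W : C} (f : S ⊗ X ⟶ S ⊗ Y) (g : S ⊗ Y ⟶ S ⊗ W) :
    wl Z (f ≫ g) = wl Z f ≫ wl Z g := by
  simp [wl, sw_sw_assoc]

lemma wr_comp {S X Y W : C} (f : S ⊗ X ⟶ S ⊗ Y) (g : S ⊗ Y ⟶ S ⊗ W) (Z : C) :
    wr (f ≫ g) Z = wr f Z ≫ wr g Z := by
  simp [wr]

lemma wl_whisker (Z S : C) {X Y : C} (u : X ⟶ Y) : wl Z (S ◁ u) = S ◁ Z ◁ u := by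
  rw [wl, sw_nat3, sw_sw_assoc]

lemma wr_whisker (Z S : C) {X Y : C} (u : X ⟶ Y) : wr (S ◁ u) Z = S ◁ (u ▷ Z) := by
  simp [wr]

lemma wl_nat {Z Z' S X Y : C} (u : Z ⟶ Z') (f : S ⊗ X ⟶ S ⊗ Y) :
    wl Z f ≫ S ◁ (u ▷ Y) = S ◁ (u ▷ X) ≫ wl Z' f := by
  simp only [wl, Category.assoc]
  rw [← sw_nat1, whisker_exchange_assoc]
  rw [← Category.assoc (S ◁ _), sw_nat2, Category.assoc]

lemma wl_tensor (T U : C) {S X Y : C} (f : S ⊗ X ⟶ S ⊗ Y) :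
    wl (T ⊗ U) f = S ◁ (α_ T U X).hom ≫ wl T (wl U f) ≫ S ◁ (α_ T U Y).inv := by
  have h1 : sw S (T ⊗ U) X =
      S ◁ (α_ T U X).hom ≫ sw S T (U ⊗ X) ≫ T ◁ sw S U X ≫ (α_ T U (S ⊗ X)).inv := by
    have := sw_tensor_right S T U X
    rw [← Iso.eq_comp_inv] at this
    simpa using this
  have h2 : sw (T ⊗ U) S Y =
      (α_ T U (S ⊗ Y)).hom ≫ T ◁ sw U S Y ≫ sw T S (U ⊗ Y) ≫ S ◁ (α_ T U Y).inv := by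
    have := sw_tensor_left T U S Y
    rw [← Category.assoc, ← Category.assoc]
    rw [← whiskerLeftIso_inv, Iso.eq_comp_inv, whiskerLeftIso_hom, ← this, Category.assoc]
  rw [wl, h1, h2]
  simp [wl]

lemma wl_sw (T U : C) {S X Y : C} (f : S ⊗ X ⟶ S ⊗ Y) :
    wl T (wl U f) ≫ S ◁ sw T U Y = S ◁ sw T U X ≫ wl U (wl T f) := by
  have h1 : wl T (wl U f) = S ◁ (α_ T U X).inv ≫ wl (T ⊗ U) f ≫ S ◁ (α_ T U Y).hom := by
    simp [wl_tensor]
  have h2 : wl U (wl T f) = S ◁ (α_ U T X).inv ≫ wl (U ⊗ T) f ≫ S ◁ (α_ U T Y).hom := by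
    simp [wl_tensor]
  have h3 := wl_nat (β_ T U).hom f
  rw [h1, h2]
  simp only [sw, whiskerLeft_comp, Category.assoc, whiskerLeft_hom_inv_assoc,
    reassoc_of% h3]

lemma wl_sw_assoc (T U : C) {S X Y : C} (f : S ⊗ X ⟶ S ⊗ Y) {W : C} (h : _ ⟶ W) :
    wl T (wl U f) ≫ S ◁ sw T U Y ≫ h = S ◁ sw T U X ≫ wl U (wl T f) ≫ h := by
  rw [← Category.assoc, wl_sw, Category.assoc]

lemma wl_unit {S X Y : C} (f : S ⊗ X ⟶ S ⊗ Y) :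
    wl (𝟙_ C) f = S ◁ (λ_ X).hom ≫ f ≫ S ◁ (λ_ Y).inv := by
  simp [wl, sw_unit_left, sw_unit_right]

lemma wr_tensor {S X Y : C} (f : S ⊗ X ⟶ S ⊗ Y) (T U : C) :
    wr f (T ⊗ U) = S ◁ (α_ X T U).inv ≫ wr (wr f T) U ≫ S ◁ (α_ Y T U).hom := by
  simp [wr]

lemma wr_unit {S X Y : C} (f : S ⊗ X ⟶ S ⊗ Y) :
    wr f (𝟙_ C) = S ◁ (ρ_ X).hom ≫ f ≫ S ◁ (ρ_ Y).inv := by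
  simp [wr]

lemma wl_wr (Z W : C) {S X Y : C} (f : S ⊗ X ⟶ S ⊗ Y) :
    wr (wl Z f) W = S ◁ (α_ Z X W).hom ≫ wl Z (wr f W) ≫ S ◁ (α_ Z Y W).inv := by
  have h1 := sw_whisker S Z X W
  have h2 := sw_whisker Z S Y W
  simp only [wr, wl, comp_whiskerRight, Category.assoc, whiskerLeft_comp]
  rw [← cancel_epi (α_ S (Z ⊗ X) W).hom, ← cancel_mono (S ◁ (α_ Z Y W).hom)]
  simp only [Category.assoc, h2, Iso.hom_inv_id_assoc]
  simp [← reassoc_of% h1]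

lemma wl_braid (Z : C) {S X Y : C} (f : S ⊗ X ⟶ S ⊗ Y) :
    wl Z f ≫ S ◁ (β_ Z Y).hom = S ◁ (β_ Z X).hom ≫ wr f Z := by
  have h1 : sw Z S Y ≫ S ◁ (β_ Z Y).hom = (β_ Z (S ⊗ Y)).hom ≫ (α_ S Y Z).hom := by
    simp [sw]
  have h2 : sw S Z X ≫ (β_ Z (S ⊗ X)).hom = S ◁ (β_ Z X).hom ≫ (α_ S X Z).inv := by
    have h3 : sw Z S X ≫ S ◁ (β_ Z X).hom = (β_ Z (S ⊗ X)).hom ≫ (α_ S X Z).hom := by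
      simp [sw]
    rw [Iso.eq_comp_inv, Category.assoc, ← h3, sw_sw_assoc]
  simp only [wl, wr, Category.assoc, h1]
  rw [BraidedCategory.braiding_naturality_right_assoc, reassoc_of% h2]

lemma wl_wr_sw (T Z : C) {S X Y : C} (f : S ⊗ X ⟶ S ⊗ Y) :
    wl T (wr f Z) ≫ S ◁ sw T Y Z = S ◁ sw T X Z ≫ wr f (T ⊗ Z) := by
  have h1 := wl_wr T Z f
  have h2 : wl T (wr f Z) = S ◁ (α_ T X Z).inv ≫ wr (wl T f) Z ≫ S ◁ (α_ T Y Z).hom := by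
    simp [h1]
  have h3 : wr (wl T f) Z ≫ S ◁ ((β_ T Y).hom ▷ Z) = S ◁ ((β_ T X).hom ▷ Z) ≫ wr (wr f T) Z := by
    rw [← wr_whisker, ← wr_comp, wl_braid, wr_comp, wr_whisker]
  rw [h2, wr_tensor]
  simp only [sw, whiskerLeft_comp, Category.assoc, whiskerLeft_hom_inv_assoc, reassoc_of% h3]

/-- The reassociation identifying `f : S ⊗ T ⊗ X ⟶ S ⊗ T ⊗ Y`, seen as a morphism with state `S`
from `T ⊗ X` to `T ⊗ Y`, with the same morphism seen with state `S ⊗ T` from `X` to `Y`: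
this underlies `tr_T (f | S) = (f | S ⊗ T)`. -/
def tRaw {S T X Y : C} (h : S ⊗ (T ⊗ X) ⟶ S ⊗ (T ⊗ Y)) : (S ⊗ T) ⊗ X ⟶ (S ⊗ T) ⊗ Y :=
  (α_ S T X).hom ≫ h ≫ (α_ S T Y).inv

lemma wl_tRaw (Z : C) {S T X Y : C} (h : S ⊗ (T ⊗ X) ⟶ S ⊗ (T ⊗ Y)) :
    wl Z (tRaw h) = tRaw (S ◁ sw T Z X ≫ wl Z h ≫ S ◁ sw Z T Y) := by
  have h1 := sw_tensor_left S T Z X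
  have h2 : sw Z (S ⊗ T) Y =
      Z ◁ (α_ S T Y).hom ≫ sw Z S (T ⊗ Y) ≫ S ◁ sw Z T Y ≫ (α_ S T (Z ⊗ Y)).inv := by
    have := sw_tensor_right Z S T Y
    rw [← Iso.eq_comp_inv] at this
    simpa using this
  simp only [wl, tRaw, whiskerLeft_comp, Category.assoc, h2, reassoc_of% h1,
    whiskerLeft_inv_hom_assoc]

lemma wr_tRaw (Z : C) {S T X Y : C} (h : S ⊗ (T ⊗ X) ⟶ S ⊗ (T ⊗ Y)) :
    wr (tRaw h) Z = tRaw (S ◁ (α_ T X Z).inv ≫ wr h Z ≫ S ◁ (α_ T Y Z).hom) := by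
  simp [wr, tRaw]

/-- The morphism with state `S ⊗ T` that underlies the composite `(f | S) ; (g | T)`: the wire `T`
is moved aside by a symmetry while `f` acts on `S ⊗ X`, is moved back, and then `g` acts on `T ⊗ Y`. -/
def compRaw {S T X Y Z : C} (f : S ⊗ X ⟶ S ⊗ Y) (g : T ⊗ Y ⟶ T ⊗ Z) :
    (S ⊗ T) ⊗ X ⟶ (S ⊗ T) ⊗ Z :=
  (β_ S T).hom ▷ X ≫ (α_ T S X).hom ≫ T ◁ f ≫ (α_ T S Y).inv ≫
    (β_ T S).hom ▷ Y ≫ (α_ S T Y).hom ≫ S ◁ g ≫ (α_ S T Z).inv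

/-- The morphism with state `S ⊗ T` that underlies `(f | S) ⊗ (g | T)`: the middle wires are
exchanged by a symmetry, `f` and `g` are applied in parallel, and the middle wires are exchanged back. -/
def tensorRaw {S T X Y Z W : C} (f : S ⊗ X ⟶ S ⊗ Y) (g : T ⊗ Z ⟶ T ⊗ W) :
    (S ⊗ T) ⊗ (X ⊗ Z) ⟶ (S ⊗ T) ⊗ (Y ⊗ W) :=
  tensorμ S T X Z ≫ (f ⊗ₘ g) ≫ tensorδ S T Y W

lemma compRaw_eq {S T X Y Z : C} (f : S ⊗ X ⟶ S ⊗ Y) (g : T ⊗ Y ⟶ T ⊗ Z) :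
    compRaw f g = tRaw (wl T f ≫ S ◁ g) := by
  simp [compRaw, tRaw, wl, sw]

lemma tensorRaw_eq {S T X Y Z W : C} (f : S ⊗ X ⟶ S ⊗ Y) (g : T ⊗ Z ⟶ T ⊗ W) :
    tensorRaw f g = compRaw (wr f Z) (wl Y g) := by
  have h1 : tensorμ S T X Z = (α_ S T (X ⊗ Z)).hom ≫ S ◁ sw T X Z ≫ (α_ S X (T ⊗ Z)).inv := by
    simp [tensorμ, sw]
  have h2 : tensorδ S T Y W = (α_ S Y (T ⊗ W)).hom ≫ S ◁ sw Y T W ≫ (α_ S T (Y ⊗ W)).inv := by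
    simp [tensorδ, sw, ← SymmetricCategory.braiding_swap_eq_inv_braiding T Y]
  have h3 := wl_wr_sw T Z f
  rw [compRaw_eq, tensorRaw, h1, h2, tRaw, wl.eq_def Y g]
  simp only [whiskerLeft_comp, Category.assoc, reassoc_of% h3, MonoidalCategory.tensorHom_def]
  simp [wr]

end Raw

section Traced

variable (C : Type u) [Category.{v} C] [MonoidalCategory C]

/-- A monoidal category is strict if `⊗` is strictly associative and unital on objects and the
associators and unitors are the identities (the canonical isomorphisms between equal objects). -/
class IsStrictMonoidal : Prop where
  tensor_assoc : ∀ X Y Z : C, (X ⊗ Y) ⊗ Z = X ⊗ (Y ⊗ Z)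
  unit_tensor : ∀ X : C, 𝟙_ C ⊗ X = X
  tensor_unit : ∀ X : C, X ⊗ 𝟙_ C = X
  associator_eq : ∀ X Y Z : C, α_ X Y Z = eqToIso (tensor_assoc X Y Z)
  leftUnitor_eq : ∀ X : C, λ_ X = eqToIso (unit_tensor X)
  rightUnitor_eq : ∀ X : C, ρ_ X = eqToIso (tensor_unit X)

/-- A trace on a symmetric monoidal category: operators `C(S ⊗ X, S ⊗ Y) → C(X, Y)` subject to the
usual axioms. The associators and unitors are identities when the category is strict. -/
class TracedCategory [SymmetricCategory C] where
  tr : ∀ (S : C) {X Y : C}, (S ⊗ X ⟶ S ⊗ Y) → (X ⟶ Y)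
  tightening : ∀ (S : C) {X X' Y Y' : C} (u : X' ⟶ X) (f : S ⊗ X ⟶ S ⊗ Y) (v : Y ⟶ Y'),
    tr S (S ◁ u ≫ f ≫ S ◁ v) = u ≫ tr S f ≫ v
  strength : ∀ (S : C) {X Y Z W : C} (f : S ⊗ X ⟶ S ⊗ Y) (g : Z ⟶ W),
    tr S ((α_ S X Z).inv ≫ (f ⊗ₘ g) ≫ (α_ S Y W).hom) = tr S f ⊗ₘ g
  joining : ∀ (S T : C) {X Y : C} (f : S ⊗ (T ⊗ X) ⟶ S ⊗ (T ⊗ Y)),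
    tr T (tr S f) = tr (S ⊗ T) ((α_ S T X).hom ≫ f ≫ (α_ S T Y).inv)
  vanishing : ∀ {X Y : C} (f : 𝟙_ C ⊗ X ⟶ 𝟙_ C ⊗ Y),
    tr (𝟙_ C) f = (λ_ X).inv ≫ f ≫ (λ_ Y).hom
  sliding : ∀ {S T X Y : C} (f : T ⊗ X ⟶ S ⊗ Y) (u : S ⟶ T),
    tr T (f ≫ u ▷ Y) = tr S (u ▷ X ≫ f)
  yanking : ∀ S : C, tr S (β_ S S).hom = 𝟙 S

/-- The trace is uniform: `f ; (r ⊗ id) = (r ⊗ id) ; g` implies `tr_S f = tr_T g`, for every `r`. -/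
class IsUniformlyTraced [SymmetricCategory C] [TracedCategory C] : Prop where
  uniformity : ∀ {S T X Y : C} (f : S ⊗ X ⟶ S ⊗ Y) (g : T ⊗ X ⟶ T ⊗ Y) (r : S ⟶ T),
    f ≫ r ▷ Y = r ▷ X ≫ g → TracedCategory.tr S f = TracedCategory.tr T g

end Traced

section FreeTr

/-- A pair `(f | S)` of an object `S` and a morphism `f : S ⊗ X ⟶ S ⊗ Y`. -/
structure StHom {C : Type u} [Category.{v} C] [MonoidalCategory C] (X Y : C) where
  st : C
  hom : st ⊗ X ⟶ st ⊗ Y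

/-- The least congruence (equivalence relation closed under composition, monoidal product and trace
of pairs) that contains sliding and yanking.
* sliding: `(f ; (u ⊗ id) | T) ~ ((u ⊗ id) ; f | S)` for `f : T ⊗ X ⟶ S ⊗ Y` and `u : S ⟶ T`;
* yanking: `(σ_{S,S} | S) ~ (id_S | I)`. -/
inductive StRel {C : Type u} [Category.{v} C] [MonoidalCategory C] [SymmetricCategory C] :
    ∀ {X Y : C}, StHom X Y → StHom X Y → Prop
  | refl {X Y : C} (f : StHom X Y) : StRel f f
  | symm {X Y : C} {f g : StHom X Y} : StRel f g → StRel g f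
  | trans {X Y : C} {f g h : StHom X Y} : StRel f g → StRel g h → StRel f h
  | sliding {S T X Y : C} (f : T ⊗ X ⟶ S ⊗ Y) (u : S ⟶ T) :
      StRel ⟨T, f ≫ u ▷ Y⟩ ⟨S, u ▷ X ≫ f⟩
  | yanking (S : C) : StRel ⟨S, (β_ S S).hom⟩ ⟨𝟙_ C, 𝟙 (𝟙_ C ⊗ S)⟩
  | comp {X Y Z : C} {f f' : StHom X Y} {g g' : StHom Y Z} : StRel f f' → StRel g g' →
      StRel ⟨f.st ⊗ g.st, compRaw f.hom g.hom⟩ ⟨f'.st ⊗ g'.st, compRaw f'.hom g'.hom⟩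
  | tensor {X Y Z W : C} {f f' : StHom X Y} {g g' : StHom Z W} : StRel f f' → StRel g g' →
      StRel ⟨f.st ⊗ g.st, tensorRaw f.hom g.hom⟩ ⟨f'.st ⊗ g'.st, tensorRaw f'.hom g'.hom⟩
  | trace (T : C) {X Y : C} {f f' : StHom (T ⊗ X) (T ⊗ Y)} : StRel f f' →
      StRel ⟨f.st ⊗ T, tRaw f.hom⟩ ⟨f'.st ⊗ T, tRaw f'.hom⟩

variable {C : Type u} [Category.{v} C] [MonoidalCategory C] [SymmetricCategory C]

lemma StRel.iso {S T X Y : C} {f : S ⊗ X ⟶ S ⊗ Y} {g : T ⊗ X ⟶ T ⊗ Y} (e : S ≅ T)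
    (h : f ≫ e.hom ▷ Y = e.hom ▷ X ≫ g) : StRel ⟨S, f⟩ ⟨T, g⟩ := by
  have := StRel.sliding (e.inv ▷ X ≫ f) e.hom
  simp only [Category.assoc, h, inv_hom_whiskerRight_assoc, hom_inv_whiskerRight_assoc] at this
  exact this.symm

instance stSetoid (X Y : C) : Setoid (StHom X Y) where
  r := StRel
  iseqv := ⟨StRel.refl, StRel.symm, StRel.trans⟩

/-- Morphisms of the free traced category: pairs `(f | S)` modulo sliding and yanking. -/
def TrHom (X Y : C) : Type (max u v) := Quotient (stSetoid X Y)

namespace TrHom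

/-- The class of the pair `(f | S)`. -/
def mk {X Y : C} (S : C) (f : S ⊗ X ⟶ S ⊗ Y) : TrHom X Y := Quotient.mk (stSetoid X Y) ⟨S, f⟩

/-- Composition, `(f | S) ; (g | T)` having state `S ⊗ T`. -/
def comp {X Y Z : C} (f : TrHom X Y) (g : TrHom Y Z) : TrHom X Z :=
  Quotient.map₂ (fun f g => ⟨f.st ⊗ g.st, compRaw f.hom g.hom⟩)
    (fun _ _ h _ _ h' => StRel.comp h h') f g

/-- Monoidal product, `(f | S) ⊗ (g | T)` having state `S ⊗ T`. -/
def tensor {X Y Z W : C} (f : TrHom X Y) (g : TrHom Z W) : TrHom (X ⊗ Z) (Y ⊗ W) :=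
  Quotient.map₂ (fun f g => ⟨f.st ⊗ g.st, tensorRaw f.hom g.hom⟩)
    (fun _ _ h _ _ h' => StRel.tensor h h') f g

/-- Trace, `tr_T (f | S) = (f | S ⊗ T)`. -/
def trace (T : C) {X Y : C} (f : TrHom (T ⊗ X) (T ⊗ Y)) : TrHom X Y :=
  Quotient.map (fun f => ⟨f.st ⊗ T, tRaw f.hom⟩) (fun _ _ h => StRel.trace T h) f

/-- The class `(f | I)` of a morphism `f` of `C`. -/
def incl {X Y : C} (f : X ⟶ Y) : TrHom X Y := mk (𝟙_ C) (𝟙_ C ◁ f)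

/-- The identity `(id | I)`. -/
def id (X : C) : TrHom X X := mk (𝟙_ C) (𝟙 _)

lemma mk_iso {S T X Y : C} {f : S ⊗ X ⟶ S ⊗ Y} {g : T ⊗ X ⟶ T ⊗ Y} (e : S ≅ T)
    (h : f ≫ e.hom ▷ Y = e.hom ▷ X ≫ g) : mk S f = mk T g :=
  Quotient.sound (StRel.iso e h)

lemma exists_rep {X Y : C} (f : TrHom X Y) : ∃ (S : C) (f' : S ⊗ X ⟶ S ⊗ Y), mk S f' = f := by
  induction f using Quotient.ind with
  | _ f => exact ⟨f.st, f.hom, rfl⟩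

lemma comp_mk {S T X Y Z : C} (f : S ⊗ X ⟶ S ⊗ Y) (g : T ⊗ Y ⟶ T ⊗ Z) :
    comp (mk S f) (mk T g) = mk (S ⊗ T) (tRaw (wl T f ≫ S ◁ g)) := by
  rw [← compRaw_eq]; rfl

lemma comp_mk' {S T X Y Z : C} (f : S ⊗ X ⟶ S ⊗ Y) (g : T ⊗ Y ⟶ T ⊗ Z) :
    comp (mk S f) (mk T g) = mk (T ⊗ S) (tRaw (T ◁ f ≫ wl S g)) := by
  rw [comp_mk]
  refine mk_iso (β_ S T) ?_
  have h1 : tRaw (wl T f ≫ S ◁ g) ≫ (β_ S T).hom ▷ Z =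
      (α_ _ _ _).hom ≫ (wl T f ≫ S ◁ g) ≫ sw S T Z ≫ (α_ _ _ _).inv := by simp [tRaw, sw]
  have h2 : (β_ S T).hom ▷ X ≫ tRaw (T ◁ f ≫ wl S g) =
      (α_ _ _ _).hom ≫ sw S T X ≫ (T ◁ f ≫ wl S g) ≫ (α_ _ _ _).inv := by simp [tRaw, sw]
  rw [h1, h2]
  simp [wl]

lemma incl_comp_mk {S X Y Z : C} (u : X ⟶ Y) (f : S ⊗ Y ⟶ S ⊗ Z) :
    comp (incl u) (mk S f) = mk S (S ◁ u ≫ f) := by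
  rw [incl, comp_mk, wl_whisker]
  refine mk_iso (λ_ S) ?_
  simp [tRaw]

lemma mk_comp_incl {S X Y Z : C} (f : S ⊗ X ⟶ S ⊗ Y) (v : Y ⟶ Z) :
    comp (mk S f) (incl v) = mk S (f ≫ S ◁ v) := by
  rw [incl, comp_mk', wl_whisker]
  refine mk_iso (λ_ S) ?_
  simp [tRaw]

lemma incl_comp_incl {X Y Z : C} (u : X ⟶ Y) (v : Y ⟶ Z) :
    comp (incl u) (incl v) = incl (u ≫ v) := by
  rw [incl, mk_comp_incl]; simp [incl]

lemma incl_id (X : C) : incl (𝟙 X) = id X := by simp [incl, id]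

lemma incl_hom_inv {X Y : C} (e : X ≅ Y) : comp (incl e.hom) (incl e.inv) = id X := by
  rw [incl_comp_incl, e.hom_inv_id, incl_id]

lemma incl_inv_hom {X Y : C} (e : X ≅ Y) : comp (incl e.inv) (incl e.hom) = id Y := by
  rw [incl_comp_incl, e.inv_hom_id, incl_id]

lemma id_comp {X Y : C} (f : TrHom X Y) : comp (id X) f = f := by
  obtain ⟨S, f, rfl⟩ := exists_rep f
  rw [← incl_id, incl_comp_mk]; simp

lemma comp_id {X Y : C} (f : TrHom X Y) : comp f (id Y) = f := by
  obtain ⟨S, f, rfl⟩ := exists_rep f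
  rw [← incl_id, mk_comp_incl]; simp

lemma comp_assoc {W X Y Z : C} (f : TrHom W X) (g : TrHom X Y) (h : TrHom Y Z) :
    comp (comp f g) h = comp f (comp g h) := by
  obtain ⟨S, f, rfl⟩ := exists_rep f
  obtain ⟨T, g, rfl⟩ := exists_rep g
  obtain ⟨U, h, rfl⟩ := exists_rep h
  rw [comp_mk, comp_mk, comp_mk, comp_mk]
  refine mk_iso (α_ S T U) ?_
  rw [wl_tRaw, wl_comp, wl_whisker, wl_tensor, Category.assoc, ← wl_sw_assoc]
  simp [tRaw, wl]

/-- whiskering by an object -/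
lemma id_tensor_mk (Z : C) {S X Y : C} (f : S ⊗ X ⟶ S ⊗ Y) :
    tensor (id Z) (mk S f) = mk S (wl Z f) := by
  have h : tensor (id Z) (mk S f) = mk (𝟙_ C ⊗ S) (tensorRaw (𝟙 _) f) := rfl
  rw [h, tensorRaw_eq, compRaw_eq, ← comp_mk]
  have : wr (𝟙 (𝟙_ C ⊗ Z)) X = 𝟙 _ := by simp [wr]
  rw [this]
  exact id_comp _

lemma mk_tensor_id {S X Y : C} (f : S ⊗ X ⟶ S ⊗ Y) (Z : C) :
    tensor (mk S f) (id Z) = mk S (wr f Z) := by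
  have h : tensor (mk S f) (id Z) = mk (S ⊗ 𝟙_ C) (tensorRaw f (𝟙 _)) := rfl
  rw [h, tensorRaw_eq, compRaw_eq, ← comp_mk]
  have : wl Y (𝟙 (𝟙_ C ⊗ Z)) = 𝟙 _ := by simp [wl, sw_sw]
  rw [this]
  exact comp_id _

lemma tensor_def {X Y Z W : C} (f : TrHom X Y) (g : TrHom Z W) :
    tensor f g = comp (tensor f (id Z)) (tensor (id Y) g) := by
  obtain ⟨S, f, rfl⟩ := exists_rep f
  obtain ⟨T, g, rfl⟩ := exists_rep g
  rw [id_tensor_mk, mk_tensor_id, comp_mk, ← compRaw_eq, ← tensorRaw_eq]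
  rfl

lemma exchange {X Y Z W : C} (f : TrHom X Y) (g : TrHom Z W) :
    comp (tensor (id X) g) (tensor f (id W)) = comp (tensor f (id Z)) (tensor (id Y) g) := by
  obtain ⟨S, f, rfl⟩ := exists_rep f
  obtain ⟨T, g, rfl⟩ := exists_rep g
  rw [id_tensor_mk, mk_tensor_id, mk_tensor_id, id_tensor_mk, comp_mk', comp_mk]
  congr 2
  have h1 := wl_wr_sw T Z f
  have h2 : S ◁ sw X T W ≫ wl T (wr f W) = wr f (T ⊗ W) ≫ S ◁ sw Y T W := by
    have h := wl_wr_sw T W f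
    have h' : S ◁ sw Y T W ≫ S ◁ sw T Y W = 𝟙 _ := by rw [← whiskerLeft_comp, sw_sw]; simp
    have h'' : S ◁ sw X T W ≫ S ◁ sw T X W = 𝟙 _ := by rw [← whiskerLeft_comp, sw_sw]; simp
    have h₃ : S ◁ sw T Y W ≫ S ◁ sw Y T W = 𝟙 _ := by rw [← whiskerLeft_comp, sw_sw]; simp
    calc _ = S ◁ sw X T W ≫ wl T (wr f W) ≫ S ◁ sw T Y W ≫ S ◁ sw Y T W := by rw [h₃]; simp
      _ = _ := by rw [reassoc_of% h, reassoc_of% h'']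
  have h3 : S ◁ X ◁ g ≫ wr f (T ⊗ W) = wr f (T ⊗ Z) ≫ S ◁ Y ◁ g := by
    simp only [wr, Category.assoc]
    rw [← associator_naturality_right, associator_inv_naturality_right_assoc, whisker_exchange_assoc]
  simp only [wl.eq_def X g, wl.eq_def Y g, whiskerLeft_comp, Category.assoc, h2, reassoc_of% h3,
    reassoc_of% h1]

lemma id_tensor_id (X Y : C) : tensor (id X) (id Y) = id (X ⊗ Y) := by
  rw [id.eq_def Y, id_tensor_mk]
  simp [wl, sw_sw, id]

lemma id_tensor_comp (W : C) {X Y Z : C} (f : TrHom X Y) (g : TrHom Y Z) :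
    tensor (id W) (comp f g) = comp (tensor (id W) f) (tensor (id W) g) := by
  obtain ⟨S, f, rfl⟩ := exists_rep f
  obtain ⟨T, g, rfl⟩ := exists_rep g
  rw [id_tensor_mk, id_tensor_mk, comp_mk, comp_mk, id_tensor_mk, wl_tRaw, wl_comp, wl_whisker,
    Category.assoc, ← wl_sw_assoc]
  simp only [wl, whiskerLeft_comp]

lemma comp_tensor_id {X Y Z : C} (f : TrHom X Y) (g : TrHom Y Z) (W : C) :
    tensor (comp f g) (id W) = comp (tensor f (id W)) (tensor g (id W)) := by
  obtain ⟨S, f, rfl⟩ := exists_rep f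
  obtain ⟨T, g, rfl⟩ := exists_rep g
  rw [mk_tensor_id, mk_tensor_id, comp_mk, comp_mk, mk_tensor_id, wr_tRaw, wr_comp, wr_whisker,
    wl_wr]
  congr 2
  simp [wr]

lemma tensor_comp_tensor {X₁ Y₁ Z₁ X₂ Y₂ Z₂ : C} (f₁ : TrHom X₁ Y₁) (f₂ : TrHom X₂ Y₂)
    (g₁ : TrHom Y₁ Z₁) (g₂ : TrHom Y₂ Z₂) :
    comp (tensor f₁ f₂) (tensor g₁ g₂) = tensor (comp f₁ g₁) (comp f₂ g₂) := by
  rw [tensor_def f₁, tensor_def g₁, tensor_def (comp f₁ g₁), comp_tensor_id, id_tensor_comp]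
  simp only [comp_assoc]
  rw [← comp_assoc (tensor (id Y₁) f₂), exchange]
  simp only [comp_assoc]

lemma id_tensor_incl (Z : C) {X Y : C} (u : X ⟶ Y) : tensor (id Z) (incl u) = incl (Z ◁ u) := by
  rw [incl, id_tensor_mk, wl_whisker]; rfl

lemma incl_tensor_id {X Y : C} (u : X ⟶ Y) (Z : C) : tensor (incl u) (id Z) = incl (u ▷ Z) := by
  rw [incl, mk_tensor_id, wr_whisker]; rfl

lemma incl_tensor_incl {X Y Z W : C} (u : X ⟶ Y) (v : Z ⟶ W) :
    tensor (incl u) (incl v) = incl (u ⊗ₘ v) := by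
  rw [tensor_def, id_tensor_incl, incl_tensor_id, incl_comp_incl, MonoidalCategory.tensorHom_def]

lemma leftUnitor_naturality {X Y : C} (f : TrHom X Y) :
    comp (tensor (id (𝟙_ C)) f) (incl (λ_ Y).hom) = comp (incl (λ_ X).hom) f := by
  obtain ⟨S, f, rfl⟩ := exists_rep f
  rw [id_tensor_mk, mk_comp_incl, incl_comp_mk, wl_unit]
  simp

lemma rightUnitor_naturality {X Y : C} (f : TrHom X Y) :
    comp (tensor f (id (𝟙_ C))) (incl (ρ_ Y).hom) = comp (incl (ρ_ X).hom) f := by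
  obtain ⟨S, f, rfl⟩ := exists_rep f
  rw [mk_tensor_id, mk_comp_incl, incl_comp_mk, wr_unit]
  simp

lemma assoc_nat_left {X Y : C} (f : TrHom X Y) (Z W : C) :
    comp (tensor (tensor f (id Z)) (id W)) (incl (α_ Y Z W).hom) =
      comp (incl (α_ X Z W).hom) (tensor f (id (Z ⊗ W))) := by
  obtain ⟨S, f, rfl⟩ := exists_rep f
  rw [mk_tensor_id, mk_tensor_id, mk_tensor_id, mk_comp_incl, incl_comp_mk, wr_tensor]
  simp

lemma assoc_nat_middle (Z : C) {X Y : C} (f : TrHom X Y) (W : C) :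
    comp (tensor (tensor (id Z) f) (id W)) (incl (α_ Z Y W).hom) =
      comp (incl (α_ Z X W).hom) (tensor (id Z) (tensor f (id W))) := by
  obtain ⟨S, f, rfl⟩ := exists_rep f
  rw [id_tensor_mk, mk_tensor_id, mk_tensor_id, id_tensor_mk, mk_comp_incl, incl_comp_mk, wl_wr]
  simp

lemma assoc_nat_right (Z W : C) {X Y : C} (f : TrHom X Y) :
    comp (tensor (id (Z ⊗ W)) f) (incl (α_ Z W Y).hom) =
      comp (incl (α_ Z W X).hom) (tensor (id Z) (tensor (id W) f)) := by
  obtain ⟨S, f, rfl⟩ := exists_rep f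
  rw [id_tensor_mk, id_tensor_mk, id_tensor_mk, mk_comp_incl, incl_comp_mk, wl_tensor]
  simp

lemma associator_naturality {X₁ X₂ X₃ Y₁ Y₂ Y₃ : C} (f₁ : TrHom X₁ Y₁) (f₂ : TrHom X₂ Y₂)
    (f₃ : TrHom X₃ Y₃) :
    comp (tensor (tensor f₁ f₂) f₃) (incl (α_ Y₁ Y₂ Y₃).hom) =
      comp (incl (α_ X₁ X₂ X₃).hom) (tensor f₁ (tensor f₂ f₃)) := by
  rw [tensor_def (tensor f₁ f₂), tensor_def f₁ f₂, tensor_def f₁ (tensor f₂ f₃), tensor_def f₂ f₃,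
    comp_tensor_id, id_tensor_comp, comp_assoc, assoc_nat_right, comp_assoc,
    ← comp_assoc _ (incl _), assoc_nat_middle, comp_assoc, ← comp_assoc _ (incl _), assoc_nat_left,
    comp_assoc]

lemma braiding_naturality_right (Z : C) {X Y : C} (f : TrHom X Y) :
    comp (tensor (id Z) f) (incl (β_ Z Y).hom) = comp (incl (β_ Z X).hom) (tensor f (id Z)) := by
  obtain ⟨S, f, rfl⟩ := exists_rep f
  rw [id_tensor_mk, mk_tensor_id, mk_comp_incl, incl_comp_mk, wl_braid]

lemma braiding_naturality_left {X Y : C} (f : TrHom X Y) (Z : C) :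
    comp (tensor f (id Z)) (incl (β_ Y Z).hom) = comp (incl (β_ X Z).hom) (tensor (id Z) f) := by
  obtain ⟨S, f, rfl⟩ := exists_rep f
  rw [id_tensor_mk, mk_tensor_id, mk_comp_incl, incl_comp_mk]
  have := wl_braid Z f
  congr 1
  rw [← cancel_epi (S ◁ (β_ Z X).hom), ← reassoc_of% this]
  simp [← whiskerLeft_comp_assoc, ← whiskerLeft_comp]

lemma pentagon (W X Y Z : C) :
    comp (tensor (incl (α_ W X Y).hom) (id Z)) (comp (incl (α_ W (X ⊗ Y) Z).hom)
      (tensor (id W) (incl (α_ X Y Z).hom))) =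
      comp (incl (α_ (W ⊗ X) Y Z).hom) (incl (α_ W X (Y ⊗ Z)).hom) := by
  simp only [id_tensor_incl, incl_tensor_id, incl_comp_incl, MonoidalCategory.pentagon]

lemma triangle (X Y : C) :
    comp (incl (α_ X (𝟙_ C) Y).hom) (tensor (id X) (incl (λ_ Y).hom)) =
      tensor (incl (ρ_ X).hom) (id Y) := by
  simp only [id_tensor_incl, incl_tensor_id, incl_comp_incl, MonoidalCategory.triangle]

lemma hexagon_forward (X Y Z : C) :
    comp (incl (α_ X Y Z).hom) (comp (incl (β_ X (Y ⊗ Z)).hom) (incl (α_ Y Z X).hom)) =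
      comp (tensor (incl (β_ X Y).hom) (id Z)) (comp (incl (α_ Y X Z).hom)
        (tensor (id Y) (incl (β_ X Z).hom))) := by
  simp only [id_tensor_incl, incl_tensor_id, incl_comp_incl, BraidedCategory.hexagon_forward]

lemma hexagon_reverse (X Y Z : C) :
    comp (incl (α_ X Y Z).inv) (comp (incl (β_ (X ⊗ Y) Z).hom) (incl (α_ Z X Y).inv)) =
      comp (tensor (id X) (incl (β_ Y Z).hom)) (comp (incl (α_ X Z Y).inv)
        (tensor (incl (β_ X Z).hom) (id Y))) := by
  simp only [id_tensor_incl, incl_tensor_id, incl_comp_incl, BraidedCategory.hexagon_reverse]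

lemma symmetry (X Y : C) : comp (incl (β_ X Y).hom) (incl (β_ Y X).hom) = id (X ⊗ Y) := by
  rw [incl_comp_incl, SymmetricCategory.symmetry, incl_id]

lemma trace_mk (T : C) {S X Y : C} (f : S ⊗ (T ⊗ X) ⟶ S ⊗ (T ⊗ Y)) :
    trace T (mk S f) = mk (S ⊗ T) (tRaw f) := rfl

lemma trace_comp_left (T : C) {X' X Y : C} (u : TrHom X' X) (f : TrHom (T ⊗ X) (T ⊗ Y)) :
    trace T (comp (tensor (id T) u) f) = comp u (trace T f) := by
  obtain ⟨S, f, rfl⟩ := exists_rep f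
  obtain ⟨U, u, rfl⟩ := exists_rep u
  rw [id_tensor_mk, comp_mk, trace_mk, trace_mk, comp_mk]
  refine mk_iso (α_ U S T) ?_
  simp [tRaw, wl_tensor]

lemma trace_comp_right (T : C) {X Y Y' : C} (f : TrHom (T ⊗ X) (T ⊗ Y)) (v : TrHom Y Y') :
    trace T (comp f (tensor (id T) v)) = comp (trace T f) v := by
  obtain ⟨S, f, rfl⟩ := exists_rep f
  obtain ⟨V, v, rfl⟩ := exists_rep v
  rw [id_tensor_mk, comp_mk, trace_mk, trace_mk, comp_mk, wl_tRaw]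
  refine mk_iso ((α_ S V T) ≪≫ whiskerLeftIso S (β_ V T) ≪≫ (α_ S T V).symm) ?_
  have h1 : ∀ W : C, ((α_ S V T) ≪≫ whiskerLeftIso S (β_ V T) ≪≫ (α_ S T V).symm).hom ▷ W =
      (α_ (S ⊗ V) T W).hom ≫ (α_ S V (T ⊗ W)).hom ≫ S ◁ sw V T W ≫
        (α_ S T (V ⊗ W)).inv ≫ (α_ (S ⊗ T) V W).inv := by
    intro W; simp [sw]
  have h2 : wl T v = sw V T Y ≫ T ◁ v ≫ sw T V Y' := rfl
  rw [h1, h1]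
  simp only [tRaw, h2, Category.assoc, Iso.inv_hom_id_assoc, whiskerLeft_comp]
  rw [← whiskerLeft_comp_assoc S (sw T V Y'), sw_sw]
  simp [← whiskerLeft_comp_assoc S (sw V T X), sw_sw]

lemma trace_tensor_id (T : C) {X Y : C} (f : TrHom (T ⊗ X) (T ⊗ Y)) (Z : C) :
    trace T (comp (incl (α_ T X Z).inv) (comp (tensor f (id Z)) (incl (α_ T Y Z).hom))) =
      tensor (trace T f) (id Z) := by
  obtain ⟨S, f, rfl⟩ := exists_rep f
  rw [mk_tensor_id, mk_comp_incl, incl_comp_mk, trace_mk, trace_mk, mk_tensor_id, wr_tRaw]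

lemma tightening (T : C) {X X' Y Y' : C} (u : TrHom X' X) (f : TrHom (T ⊗ X) (T ⊗ Y))
    (v : TrHom Y Y') :
    trace T (comp (tensor (id T) u) (comp f (tensor (id T) v))) =
      comp u (comp (trace T f) v) := by
  rw [trace_comp_left, trace_comp_right]

lemma strength (T : C) {X Y Z W : C} (f : TrHom (T ⊗ X) (T ⊗ Y)) (g : TrHom Z W) :
    trace T (comp (incl (α_ T X Z).inv) (comp (tensor f g) (incl (α_ T Y W).hom))) =
      tensor (trace T f) g := by
  rw [tensor_def f g, comp_assoc, assoc_nat_right, ← comp_assoc _ (incl _), ← comp_assoc (incl _),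
    trace_comp_right, trace_tensor_id, ← tensor_def]

lemma joining (S T : C) {X Y : C} (f : TrHom (S ⊗ (T ⊗ X)) (S ⊗ (T ⊗ Y))) :
    trace T (trace S f) =
      trace (S ⊗ T) (comp (incl (α_ S T X).hom) (comp f (incl (α_ S T Y).inv))) := by
  obtain ⟨U, f, rfl⟩ := exists_rep f
  rw [mk_comp_incl, incl_comp_mk, trace_mk, trace_mk, trace_mk]
  refine mk_iso (α_ U S T) ?_
  simp [tRaw]

lemma vanishing {X Y : C} (f : TrHom (𝟙_ C ⊗ X) (𝟙_ C ⊗ Y)) :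
    trace (𝟙_ C) f = comp (incl (λ_ X).inv) (comp f (incl (λ_ Y).hom)) := by
  obtain ⟨S, f, rfl⟩ := exists_rep f
  rw [mk_comp_incl, incl_comp_mk, trace_mk]
  refine mk_iso (ρ_ S) ?_
  rw [← triangle_assoc]
  simp [tRaw]

lemma sliding {S T X Y : C} (f : TrHom (T ⊗ X) (S ⊗ Y)) (u : TrHom S T) :
    trace T (comp f (tensor u (id Y))) = trace S (comp (tensor u (id X)) f) := by
  obtain ⟨F, f, rfl⟩ := exists_rep f
  obtain ⟨U, u, rfl⟩ := exists_rep u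
  rw [mk_tensor_id, mk_tensor_id, comp_mk, comp_mk', trace_mk, trace_mk]
  have := StRel.sliding ((α_ (F ⊗ U) T X).hom ≫ (α_ F U (T ⊗ X)).hom ≫ wl U f ≫
    (α_ F U (S ⊗ Y)).inv ≫ (α_ (F ⊗ U) S Y).inv) (tRaw (F ◁ u))
  refine Eq.trans ?_ ((Quotient.sound this : mk _ _ = mk _ _).trans ?_)
  · congr 1
    simp [tRaw, wr]
  · congr 1
    simp [tRaw, wr]

lemma yanking (S : C) : trace S (incl (β_ S S).hom) = id S := by
  have h : mk S (β_ S S).hom = id S := Quotient.sound (StRel.yanking S)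
  rw [← h, incl, trace_mk]
  refine mk_iso (λ_ S) ?_
  simp [tRaw]

end TrHom

/-- The free traced monoidal category on `C`. It has the same objects as `C` (the wrapper only keeps
the two categories apart), and its morphisms are the classes of pairs `(f | S)`. -/
structure FreeTr (C : Type u) where
  as : C

namespace FreeTr

instance : Category.{max u v} (FreeTr C) where
  Hom X Y := TrHom X.as Y.as
  id X := TrHom.id X.as
  comp f g := TrHom.comp f g
  id_comp f := TrHom.id_comp f
  comp_id f := TrHom.comp_id f
  assoc f g h := TrHom.comp_assoc f g h

/-- The image in `FreeTr C` of an isomorphism of `C`. -/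
def isoIncl {X Y : C} (e : X ≅ Y) : (⟨X⟩ : FreeTr C) ≅ ⟨Y⟩ where
  hom := TrHom.incl e.hom
  inv := TrHom.incl e.inv
  hom_inv_id := TrHom.incl_hom_inv e
  inv_hom_id := TrHom.incl_inv_hom e

instance : MonoidalCategoryStruct (FreeTr C) where
  tensorObj X Y := ⟨X.as ⊗ Y.as⟩
  tensorUnit := ⟨𝟙_ C⟩
  tensorHom f g := TrHom.tensor f g
  whiskerLeft X _ _ f := TrHom.tensor (TrHom.id X.as) f
  whiskerRight f Y := TrHom.tensor f (TrHom.id Y.as)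
  associator X Y Z := isoIncl (α_ X.as Y.as Z.as)
  leftUnitor X := isoIncl (λ_ X.as)
  rightUnitor X := isoIncl (ρ_ X.as)

instance : MonoidalCategory (FreeTr C) where
  tensorHom_def f g := TrHom.tensor_def f g
  id_tensorHom_id X Y := TrHom.id_tensor_id X.as Y.as
  tensorHom_comp_tensorHom f₁ f₂ g₁ g₂ := TrHom.tensor_comp_tensor f₁ f₂ g₁ g₂
  whiskerLeft_id X Y := TrHom.id_tensor_id X.as Y.as
  id_whiskerRight X Y := TrHom.id_tensor_id X.as Y.as
  associator_naturality f₁ f₂ f₃ := TrHom.associator_naturality f₁ f₂ f₃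
  leftUnitor_naturality f := TrHom.leftUnitor_naturality f
  rightUnitor_naturality f := TrHom.rightUnitor_naturality f
  pentagon W X Y Z := TrHom.pentagon W.as X.as Y.as Z.as
  triangle X Y := TrHom.triangle X.as Y.as

instance : BraidedCategory (FreeTr C) where
  braiding X Y := isoIncl (β_ X.as Y.as)
  braiding_naturality_right X _ _ f := TrHom.braiding_naturality_right X.as f
  braiding_naturality_left f Z := TrHom.braiding_naturality_left f Z.as
  hexagon_forward X Y Z := TrHom.hexagon_forward X.as Y.as Z.as
  hexagon_reverse X Y Z := TrHom.hexagon_reverse X.as Y.as Z.as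

instance : SymmetricCategory (FreeTr C) where
  symmetry X Y := TrHom.symmetry X.as Y.as

instance : TracedCategory (FreeTr C) where
  tr S _ _ f := TrHom.trace S.as f
  tightening S _ _ _ _ u f v := TrHom.tightening S.as u f v
  strength S _ _ _ _ f g := TrHom.strength S.as f g
  joining S T _ _ f := TrHom.joining S.as T.as f
  vanishing f := TrHom.vanishing f
  sliding f u := TrHom.sliding f u
  yanking S := TrHom.yanking S.as

lemma mk_eq {X Y : C} (h : X = Y) : FreeTr.mk X = FreeTr.mk Y := congrArg _ h

lemma incl_eqToHom {X Y : C} (h : X = Y) :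
    TrHom.incl (eqToHom h) = eqToHom (mk_eq h) := by
  subst h
  exact TrHom.incl_id X

lemma isoIncl_eqToIso {X Y : C} (h : X = Y) : isoIncl (eqToIso h) = eqToIso (mk_eq h) := by
  subst h
  ext
  exact TrHom.incl_id X

instance [IsStrictMonoidal C] : IsStrictMonoidal (FreeTr C) where
  tensor_assoc _ _ _ := mk_eq (IsStrictMonoidal.tensor_assoc _ _ _)
  unit_tensor _ := mk_eq (IsStrictMonoidal.unit_tensor _)
  tensor_unit _ := mk_eq (IsStrictMonoidal.tensor_unit _)
  associator_eq X Y Z :=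
    (congrArg isoIncl (IsStrictMonoidal.associator_eq X.as Y.as Z.as)).trans (isoIncl_eqToIso _)
  leftUnitor_eq X :=
    (congrArg isoIncl (IsStrictMonoidal.leftUnitor_eq X.as)).trans (isoIncl_eqToIso _)
  rightUnitor_eq X :=
    (congrArg isoIncl (IsStrictMonoidal.rightUnitor_eq X.as)).trans (isoIncl_eqToIso _)

end FreeTr
end FreeTr

section Functors

/-- A strict symmetric monoidal functor between (strict) symmetric monoidal categories: it preserves
the unit object, the tensor product of objects and of morphisms, and the symmetries on the nose.
The morphisms `eqToHom` are the identities that these equalities of objects give. -/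
structure IsStrictSymmetric {C : Type*} [Category* C] [MonoidalCategory C] [BraidedCategory C]
    {D : Type*} [Category* D] [MonoidalCategory D] [BraidedCategory D] (F : C ⥤ D) : Prop where
  obj_tensor : ∀ X Y : C, F.obj (X ⊗ Y) = F.obj X ⊗ F.obj Y
  obj_unit : F.obj (𝟙_ C) = 𝟙_ D
  map_tensor : ∀ {X Y Z W : C} (f : X ⟶ Y) (g : Z ⟶ W),
    F.map (f ⊗ₘ g) =
      eqToHom (obj_tensor X Z) ≫ (F.map f ⊗ₘ F.map g) ≫ eqToHom (obj_tensor Y W).symm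
  map_braiding : ∀ X Y : C,
    F.map (β_ X Y).hom =
      eqToHom (obj_tensor X Y) ≫ (β_ (F.obj X) (F.obj Y)).hom ≫ eqToHom (obj_tensor Y X).symm

/-- A morphism of traced monoidal categories: a strict symmetric monoidal functor `F` such that
`F (tr_S f) = tr_{F S} (F f)`. -/
structure IsStrictTraced {C : Type*} [Category* C] [MonoidalCategory C] [SymmetricCategory C]
    [TracedCategory C] {D : Type*} [Category* D] [MonoidalCategory D] [SymmetricCategory D]
    [TracedCategory D] (F : C ⥤ D) : Prop extends IsStrictSymmetric F where
  map_tr : ∀ (S : C) {X Y : C} (f : S ⊗ X ⟶ S ⊗ Y),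
    F.map (TracedCategory.tr S f) =
      TracedCategory.tr (F.obj S) (eqToHom (obj_tensor S X).symm ≫ F.map f ≫ eqToHom (obj_tensor S Y))

lemma isStrictSymmetric_id (C : Type*) [Category* C] [MonoidalCategory C] [BraidedCategory C] :
    IsStrictSymmetric (𝟭 C) where
  obj_tensor _ _ := rfl
  obj_unit := rfl
  map_tensor _ _ := by simp
  map_braiding _ _ := by simp

lemma tensor_eqToHom {C : Type*} [Category* C] [MonoidalCategory C] {X X' Y Y' : C} (h : X = X')
    (h' : Y = Y') : eqToHom h ⊗ₘ eqToHom h' = eqToHom (congrArg₂ tensorObj h h') := by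
  subst h h'; simp

variable {C : Type*} [Category* C] [MonoidalCategory C]
  {D : Type*} [Category* D] [MonoidalCategory D]
  {E : Type*} [Category* E] [MonoidalCategory E]

lemma IsStrictSymmetric.comp [BraidedCategory C] [BraidedCategory D] [BraidedCategory E]
    {F : C ⥤ D} {G : D ⥤ E} (hF : IsStrictSymmetric F) (hG : IsStrictSymmetric G) :
    IsStrictSymmetric (F ⋙ G) where
  obj_tensor X Y := (congrArg G.obj (hF.obj_tensor X Y)).trans (hG.obj_tensor _ _)
  obj_unit := (congrArg G.obj hF.obj_unit).trans hG.obj_unit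
  map_tensor _ _ := by simp [hF.map_tensor, hG.map_tensor, eqToHom_map]
  map_braiding _ _ := by simp [hF.map_braiding, hG.map_braiding, eqToHom_map]

lemma isStrictTraced_id (C : Type*) [Category* C] [MonoidalCategory C] [SymmetricCategory C]
    [TracedCategory C] : IsStrictTraced (𝟭 C) where
  toIsStrictSymmetric := isStrictSymmetric_id C
  map_tr _ _ _ _ := by simp

lemma IsStrictTraced.comp [SymmetricCategory C] [SymmetricCategory D] [SymmetricCategory E]
    [TracedCategory C] [TracedCategory D] [TracedCategory E]
    {F : C ⥤ D} {G : D ⥤ E} (hF : IsStrictTraced F) (hG : IsStrictTraced G) :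
    IsStrictTraced (F ⋙ G) where
  toIsStrictSymmetric := hF.toIsStrictSymmetric.comp hG.toIsStrictSymmetric
  map_tr _ _ _ _ := by simp [hF.map_tr, hG.map_tr, eqToHom_map]

/-- A strict symmetric monoidal functor between strict monoidal categories is a monoidal functor. -/
abbrev IsStrictSymmetric.coreMonoidal [BraidedCategory C] [BraidedCategory D]
    [IsStrictMonoidal C] [IsStrictMonoidal D] {F : C ⥤ D} (hF : IsStrictSymmetric F) :
    F.CoreMonoidal where
  εIso := eqToIso hF.obj_unit.symm
  μIso X Y := eqToIso (hF.obj_tensor X Y).symm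
  μIso_hom_natural_left f X' := by
    have := hF.map_tensor f (𝟙 X')
    simp_all
  μIso_hom_natural_right X' f := by
    have := hF.map_tensor (𝟙 X') f
    simp_all
  associativity X Y Z := by
    simp [IsStrictMonoidal.associator_eq, eqToHom_map]
  left_unitality X := by
    simp [IsStrictMonoidal.leftUnitor_eq, eqToHom_map]
  right_unitality X := by
    simp [IsStrictMonoidal.rightUnitor_eq, eqToHom_map]

/-- A strict symmetric monoidal functor between strict monoidal categories is a braided functor. -/
abbrev IsStrictSymmetric.braided [BraidedCategory C] [BraidedCategory D]
    [IsStrictMonoidal C] [IsStrictMonoidal D] {F : C ⥤ D} (hF : IsStrictSymmetric F) :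
    F.Braided where
  toMonoidal := hF.coreMonoidal.toMonoidal
  braided X Y := by
    change eqToHom (hF.obj_tensor X Y).symm ≫ _ = _ ≫ eqToHom (hF.obj_tensor Y X).symm
    simp [hF.map_braiding]

end Functors

section FreeTrMap

open Functor.LaxMonoidal Functor.OplaxMonoidal

variable {C : Type*} [Category* C] [MonoidalCategory C] [SymmetricCategory C]
  {D : Type*} [Category* D] [MonoidalCategory D] [SymmetricCategory D]

/-- The image under a strict functor of `f : S ⊗ X ⟶ S ⊗ Y`, as a morphism `F S ⊗ F X ⟶ F S ⊗ F Y`. -/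
def mapRaw {F : C ⥤ D} (hF : IsStrictSymmetric F) {S X Y : C} (f : S ⊗ X ⟶ S ⊗ Y) :
    F.obj S ⊗ F.obj X ⟶ F.obj S ⊗ F.obj Y :=
  eqToHom (hF.obj_tensor S X).symm ≫ F.map f ≫ eqToHom (hF.obj_tensor S Y)

lemma mapRaw_comp {F : C ⥤ D} (hF : IsStrictSymmetric F) {S X Y Z : C} (f : S ⊗ X ⟶ S ⊗ Y)
    (g : S ⊗ Y ⟶ S ⊗ Z) : mapRaw hF (f ≫ g) = mapRaw hF f ≫ mapRaw hF g := by
  simp [mapRaw]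

section

variable [IsStrictMonoidal C] [IsStrictMonoidal D] {F : C ⥤ D} (hF : IsStrictSymmetric F)

lemma mapRaw_compRaw {S T X Y Z : C} (f : S ⊗ X ⟶ S ⊗ Y) (g : T ⊗ Y ⟶ T ⊗ Z) :
    mapRaw hF (compRaw f g) ≫ eqToHom (hF.obj_tensor S T) ▷ F.obj Z =
      eqToHom (hF.obj_tensor S T) ▷ F.obj X ≫ compRaw (mapRaw hF f) (mapRaw hF g) := by
  let := hF.braided
  change (μ F (S ⊗ T) X ≫ F.map (compRaw f g) ≫ δ F (S ⊗ T) Z) ≫ δ F S T ▷ F.obj Z =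
    δ F S T ▷ F.obj X ≫ compRaw (μ F S X ≫ F.map f ≫ δ F S Y) (μ F T Y ≫ F.map g ≫ δ F T Z)
  simp only [compRaw, Functor.map_comp, Category.assoc, whiskerLeft_comp, comp_whiskerRight, Functor.map_braiding, Functor.Monoidal.map_whiskerLeft, Functor.Monoidal.map_whiskerRight,
    Functor.Monoidal.map_associator, Functor.Monoidal.map_associator_inv]
  simp only [Category.assoc, Functor.Monoidal.μ_δ, Functor.Monoidal.δ_μ, Functor.Monoidal.μ_δ_assoc, Functor.Monoidal.δ_μ_assoc,
    Functor.Monoidal.whiskerRight_μ_δ, Functor.Monoidal.whiskerRight_μ_δ_assoc, Functor.Monoidal.whiskerRight_δ_μ_assoc,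
    Functor.Monoidal.whiskerLeft_μ_δ, Functor.Monoidal.whiskerLeft_μ_δ_assoc, Functor.Monoidal.whiskerLeft_δ_μ_assoc, Category.comp_id]

lemma mapRaw_tRaw {S T X Y : C} (f : S ⊗ (T ⊗ X) ⟶ S ⊗ (T ⊗ Y)) :
    mapRaw hF (tRaw f) ≫ eqToHom (hF.obj_tensor S T) ▷ F.obj Y =
      eqToHom (hF.obj_tensor S T) ▷ F.obj X ≫ tRaw (F.obj S ◁ eqToHom (hF.obj_tensor T X).symm ≫
        mapRaw hF f ≫ F.obj S ◁ eqToHom (hF.obj_tensor T Y)) := by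
  let := hF.braided
  change (μ F (S ⊗ T) X ≫ F.map (tRaw f) ≫ δ F (S ⊗ T) Y) ≫ δ F S T ▷ F.obj Y =
    δ F S T ▷ F.obj X ≫ tRaw (F.obj S ◁ μ F T X ≫ (μ F S _ ≫ F.map f ≫ δ F S _) ≫
      F.obj S ◁ δ F T Y)
  simp only [tRaw, Functor.map_comp, Category.assoc, whiskerLeft_comp, comp_whiskerRight, Functor.map_braiding, Functor.Monoidal.map_whiskerLeft, Functor.Monoidal.map_whiskerRight,
    Functor.Monoidal.map_associator, Functor.Monoidal.map_associator_inv]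
  simp only [Category.assoc, Functor.Monoidal.μ_δ, Functor.Monoidal.δ_μ, Functor.Monoidal.μ_δ_assoc, Functor.Monoidal.δ_μ_assoc,
    Functor.Monoidal.whiskerRight_μ_δ, Functor.Monoidal.whiskerRight_μ_δ_assoc, Functor.Monoidal.whiskerRight_δ_μ_assoc,
    Functor.Monoidal.whiskerLeft_μ_δ, Functor.Monoidal.whiskerLeft_μ_δ_assoc, Functor.Monoidal.whiskerLeft_δ_μ_assoc, Category.comp_id]

lemma map_tensorμ_eq (F : C ⥤ D) [F.Braided] (S T X Z : C) :
    F.map (tensorμ S T X Z) = δ F _ _ ≫ (δ F _ _ ⊗ₘ δ F _ _) ≫ tensorμ _ _ _ _ ≫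
      (μ F _ _ ⊗ₘ μ F _ _) ≫ μ F _ _ := by
  rw [tensorμ_comp_μ_tensorHom_μ_comp_μ, tensorHom_comp_tensorHom_assoc]
  simp only [Functor.Monoidal.δ_μ, id_tensorHom_id, Category.id_comp, Functor.Monoidal.δ_μ_assoc]

lemma mapRaw_tensorRaw {S T X Y Z W : C} (f : S ⊗ X ⟶ S ⊗ Y) (g : T ⊗ Z ⟶ T ⊗ W) :
    mapRaw hF (tensorRaw f g) ≫ eqToHom (hF.obj_tensor S T) ▷ F.obj (Y ⊗ W) =
      eqToHom (hF.obj_tensor S T) ▷ F.obj (X ⊗ Z) ≫ (_ ◁ eqToHom (hF.obj_tensor X Z) ≫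
        tensorRaw (mapRaw hF f) (mapRaw hF g) ≫ _ ◁ eqToHom (hF.obj_tensor Y W).symm) := by
  let := hF.braided
  change (μ F (S ⊗ T) _ ≫ F.map (tensorRaw f g) ≫ δ F (S ⊗ T) _) ≫ δ F S T ▷ F.obj _ =
    δ F S T ▷ F.obj _ ≫ (_ ◁ δ F X Z ≫
      tensorRaw (μ F S X ≫ F.map f ≫ δ F S Y) (μ F T Z ≫ F.map g ≫ δ F T W) ≫ _ ◁ μ F Y W)
  have h2 : F.map (tensorδ S T Y W) = δ F _ _ ≫ (δ F _ _ ⊗ₘ δ F _ _) ≫ tensorδ _ _ _ _ ≫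
      (μ F _ _ ⊗ₘ μ F _ _) ≫ μ F _ _ := by
    have : IsIso (tensorμ S T Y W) := ⟨tensorδ S T Y W, by simp, by simp⟩
    rw [← cancel_epi (F.map (tensorμ S T Y W)), ← F.map_comp, tensorμ_tensorδ, map_tensorμ_eq F S T Y W]
    simp only [Category.assoc, Functor.Monoidal.μ_δ_assoc, tensorHom_comp_tensorHom_assoc,
      Functor.Monoidal.μ_δ, id_tensorHom_id, Category.id_comp, tensorμ_tensorδ_assoc,
      Functor.Monoidal.δ_μ]
    exact F.map_id _
  have h3 : (μ F S T ⊗ₘ μ F Y W) ≫ δ F S T ▷ _ = _ ◁ μ F Y W := by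
    rw [tensorHom_def'_assoc, Functor.Monoidal.whiskerRight_μ_δ, Category.comp_id]
  simp only [tensorRaw, Functor.map_comp, map_tensorμ_eq F S T X Z, h2, Functor.Monoidal.map_tensor]
  simp only [Category.assoc, Functor.Monoidal.μ_δ_assoc, h3, tensorHom_comp_tensorHom_assoc]
  rw [MonoidalCategory.tensorHom_def_assoc]

end

section

variable [IsStrictMonoidal C] [IsStrictMonoidal D] {F : C ⥤ D} (hF : IsStrictSymmetric F)

lemma mapRaw_whiskerRight {S T : C} (u : S ⟶ T) (X : C) {Y : C} (f : T ⊗ X ⟶ S ⊗ Y) :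
    eqToHom (hF.obj_tensor S X).symm ≫ F.map (u ▷ X ≫ f) ≫ eqToHom (hF.obj_tensor S Y) =
      F.map u ▷ F.obj X ≫
        eqToHom (hF.obj_tensor T X).symm ≫ F.map f ≫ eqToHom (hF.obj_tensor S Y) := by
  let := hF.braided
  change μ F S X ≫ F.map (u ▷ X ≫ f) ≫ δ F S Y = F.map u ▷ F.obj X ≫ μ F T X ≫ F.map f ≫ δ F S Y
  simp

lemma mapRaw_whiskerRight' {S T : C} (u : S ⟶ T) (X : C) {Y : C} (f : T ⊗ X ⟶ S ⊗ Y) :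
    eqToHom (hF.obj_tensor T X).symm ≫ F.map (f ≫ u ▷ Y) ≫ eqToHom (hF.obj_tensor T Y) =
      (eqToHom (hF.obj_tensor T X).symm ≫ F.map f ≫ eqToHom (hF.obj_tensor S Y)) ≫
        F.map u ▷ F.obj Y := by
  let := hF.braided
  change μ F T X ≫ F.map (f ≫ u ▷ Y) ≫ δ F T Y = (μ F T X ≫ F.map f ≫ δ F S Y) ≫ F.map u ▷ F.obj Y
  simp

lemma mapRaw_incl {X Y : C} (u : X ⟶ Y) :
    mapRaw hF (𝟙_ C ◁ u) ≫ eqToHom hF.obj_unit ▷ F.obj Y =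
      eqToHom hF.obj_unit ▷ F.obj X ≫ 𝟙_ D ◁ F.map u := by
  let := hF.braided
  change (μ F _ X ≫ F.map (𝟙_ C ◁ u) ≫ δ F _ Y) ≫ η F ▷ F.obj Y = η F ▷ F.obj X ≫ 𝟙_ D ◁ F.map u
  simp [whisker_exchange]

lemma mk_mapRaw_comp {S T X Y Z : C} (f : S ⊗ X ⟶ S ⊗ Y) (g : T ⊗ Y ⟶ T ⊗ Z) :
    TrHom.mk _ (mapRaw hF (compRaw f g)) =
      TrHom.comp (.mk _ (mapRaw hF f)) (.mk _ (mapRaw hF g)) :=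
  TrHom.mk_iso (eqToIso (hF.obj_tensor _ _)) (mapRaw_compRaw hF f g)

lemma mk_mapRaw_tensor {S T X Y Z W : C} (f : S ⊗ X ⟶ S ⊗ Y) (g : T ⊗ Z ⟶ T ⊗ W) :
    TrHom.mk _ (mapRaw hF (tensorRaw f g)) =
      TrHom.comp (.incl (eqToHom (hF.obj_tensor X Z)))
        (TrHom.comp (TrHom.tensor (.mk _ (mapRaw hF f)) (.mk _ (mapRaw hF g)))
          (.incl (eqToHom (hF.obj_tensor Y W).symm))) := by
  have h : TrHom.tensor (.mk _ (mapRaw hF f)) (.mk _ (mapRaw hF g)) =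
      TrHom.mk _ (tensorRaw (mapRaw hF f) (mapRaw hF g)) := rfl
  rw [h, TrHom.mk_comp_incl, TrHom.incl_comp_mk]
  exact TrHom.mk_iso (eqToIso (hF.obj_tensor _ _)) (mapRaw_tensorRaw hF f g)

lemma mk_mapRaw_trace (T : C) {S X Y : C} (f : S ⊗ (T ⊗ X) ⟶ S ⊗ (T ⊗ Y)) :
    TrHom.mk _ (mapRaw hF (tRaw f)) =
      TrHom.trace (F.obj T) (TrHom.comp (.incl (eqToHom (hF.obj_tensor T X).symm))
        (TrHom.comp (.mk _ (mapRaw hF f)) (.incl (eqToHom (hF.obj_tensor T Y))))) := by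
  rw [TrHom.mk_comp_incl, TrHom.incl_comp_mk, TrHom.trace_mk]
  exact TrHom.mk_iso (eqToIso (hF.obj_tensor _ _)) (mapRaw_tRaw hF f)

lemma mk_mapRaw_incl {X Y : C} (u : X ⟶ Y) :
    TrHom.mk _ (mapRaw hF (𝟙_ C ◁ u)) = TrHom.incl (F.map u) :=
  TrHom.mk_iso (eqToIso hF.obj_unit) (mapRaw_incl hF u)

lemma mk_mapRaw_eq {X Y : C} {f g : StHom X Y} (h : StRel f g) :
    TrHom.mk _ (mapRaw hF f.hom) = TrHom.mk _ (mapRaw hF g.hom) := by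
  induction h with
  | refl f => rfl
  | symm _ ih => exact ih.symm
  | trans _ _ ih ih' => exact ih.trans ih'
  | sliding f u =>
    simp only [mapRaw]
    rw [mapRaw_whiskerRight hF u, mapRaw_whiskerRight' hF u]
    exact Quotient.sound (StRel.sliding _ _)
  | yanking S =>
    have h : mapRaw hF (β_ S S).hom = (β_ (F.obj S) (F.obj S)).hom := by
      simp [mapRaw, hF.map_braiding]
    have h' := mk_mapRaw_incl hF (𝟙 S)
    rw [whiskerLeft_id, F.map_id, TrHom.incl_id] at h'
    rw [h, h']
    exact Quotient.sound (StRel.yanking _)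
  | comp _ _ ih ih' => rw [mk_mapRaw_comp, mk_mapRaw_comp, ih, ih']
  | tensor _ _ ih ih' => rw [mk_mapRaw_tensor, mk_mapRaw_tensor, ih, ih']
  | trace T _ ih => rw [mk_mapRaw_trace, mk_mapRaw_trace, ih]

/-- The action `(f | S) ↦ (F f | F S)` of a strict functor on morphisms of the free traced categories. -/
def TrHom.map {X Y : C} (f : TrHom X Y) : TrHom (F.obj X) (F.obj Y) :=
  Quotient.lift (fun f : StHom X Y => TrHom.mk (F.obj f.st) (mapRaw hF f.hom))
    (fun _ _ h => mk_mapRaw_eq hF h) f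

lemma TrHom.map_mk {X Y S : C} (f : S ⊗ X ⟶ S ⊗ Y) :
    TrHom.map hF (.mk S f) = .mk (F.obj S) (mapRaw hF f) := rfl

lemma TrHom.map_incl {X Y : C} (u : X ⟶ Y) : TrHom.map hF (.incl u) = .incl (F.map u) :=
  mk_mapRaw_incl hF u

lemma TrHom.map_id (X : C) : TrHom.map hF (.id X) = .id (F.obj X) := by
  rw [← TrHom.incl_id, TrHom.map_incl, F.map_id, TrHom.incl_id]

lemma TrHom.map_comp {X Y Z : C} (f : TrHom X Y) (g : TrHom Y Z) :
    TrHom.map hF (TrHom.comp f g) = TrHom.comp (TrHom.map hF f) (TrHom.map hF g) := by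
  obtain ⟨S, f, rfl⟩ := exists_rep f
  obtain ⟨T, g, rfl⟩ := exists_rep g
  exact mk_mapRaw_comp hF f g

lemma TrHom.map_tensor {X Y Z W : C} (f : TrHom X Y) (g : TrHom Z W) :
    TrHom.map hF (TrHom.tensor f g) =
      TrHom.comp (.incl (eqToHom (hF.obj_tensor X Z)))
        (TrHom.comp (TrHom.tensor (TrHom.map hF f) (TrHom.map hF g))
          (.incl (eqToHom (hF.obj_tensor Y W).symm))) := by
  obtain ⟨S, f, rfl⟩ := exists_rep f
  obtain ⟨T, g, rfl⟩ := exists_rep g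
  exact mk_mapRaw_tensor hF f g

lemma TrHom.map_trace (T : C) {X Y : C} (f : TrHom (T ⊗ X) (T ⊗ Y)) :
    TrHom.map hF (TrHom.trace T f) =
      TrHom.trace (F.obj T) (TrHom.comp (.incl (eqToHom (hF.obj_tensor T X).symm))
        (TrHom.comp (TrHom.map hF f) (.incl (eqToHom (hF.obj_tensor T Y))))) := by
  obtain ⟨S, f, rfl⟩ := exists_rep f
  exact mk_mapRaw_trace hF T f

/-- The traced functor `FreeTr C ⥤ FreeTr D` induced by `F : C ⥤ D`. -/
def FreeTr.map : FreeTr C ⥤ FreeTr D where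
  obj X := ⟨F.obj X.as⟩
  map f := TrHom.map hF f
  map_id X := TrHom.map_id hF X.as
  map_comp f g := TrHom.map_comp hF f g

lemma FreeTr.isStrictTraced_map : IsStrictTraced (FreeTr.map hF) where
  obj_tensor _ _ := FreeTr.mk_eq (hF.obj_tensor _ _)
  obj_unit := FreeTr.mk_eq hF.obj_unit
  map_tensor f g := (TrHom.map_tensor hF f g).trans
    (congrArg₂ TrHom.comp (FreeTr.incl_eqToHom _)
      (congrArg₂ TrHom.comp rfl (FreeTr.incl_eqToHom _)))
  map_braiding X Y := by
    refine (TrHom.map_incl hF (β_ X.as Y.as).hom).trans ?_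
    rw [hF.map_braiding, ← TrHom.incl_comp_incl, ← TrHom.incl_comp_incl]
    exact congrArg₂ TrHom.comp (FreeTr.incl_eqToHom _)
      (congrArg₂ TrHom.comp rfl (FreeTr.incl_eqToHom _))
  map_tr S _ _ f := (TrHom.map_trace hF S.as f).trans
    (congrArg (TrHom.trace (F.obj S.as)) (congrArg₂ TrHom.comp (FreeTr.incl_eqToHom _)
      (congrArg₂ TrHom.comp rfl (FreeTr.incl_eqToHom _))))

end

lemma FreeTr.map_id (C : Type*) [Category* C] [MonoidalCategory C] [SymmetricCategory C]
    [IsStrictMonoidal C] : FreeTr.map (isStrictSymmetric_id C) = 𝟭 (FreeTr C) :=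
  CategoryTheory.Functor.hext (fun _ => rfl) fun X Y f => heq_of_eq <| by
    obtain ⟨S, f, rfl⟩ := TrHom.exists_rep f
    refine congrArg (TrHom.mk S) ?_
    simp [mapRaw]

lemma mapRaw_functor_comp {E : Type*} [Category* E] [MonoidalCategory E] [SymmetricCategory E]
    {F : C ⥤ D} {G : D ⥤ E} (hF : IsStrictSymmetric F) (hG : IsStrictSymmetric G) {S X Y : C}
    (f : S ⊗ X ⟶ S ⊗ Y) : mapRaw (hF.comp hG) f = mapRaw hG (mapRaw hF f) := by
  simp [mapRaw, eqToHom_map]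

lemma FreeTr.map_comp {E : Type*} [Category* E] [MonoidalCategory E] [SymmetricCategory E]
    [IsStrictMonoidal C] [IsStrictMonoidal D] [IsStrictMonoidal E] {F : C ⥤ D} {G : D ⥤ E}
    (hF : IsStrictSymmetric F) (hG : IsStrictSymmetric G) :
    FreeTr.map (hF.comp hG) = FreeTr.map hF ⋙ FreeTr.map hG :=
  CategoryTheory.Functor.hext (fun _ => rfl) fun X Y f => heq_of_eq <| by
    obtain ⟨S, f, rfl⟩ := TrHom.exists_rep f
    exact congrArg (TrHom.mk (G.obj (F.obj S))) (mapRaw_functor_comp hF hG f)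

end FreeTrMap

section Unif

/-- The least congruence on a traced monoidal category for which the trace is uniform. -/
inductive UnifRel {C : Type u} [Category.{v} C] [MonoidalCategory C] [SymmetricCategory C]
    [TracedCategory C] : ∀ {X Y : C}, (X ⟶ Y) → (X ⟶ Y) → Prop
  | refl {X Y : C} (f : X ⟶ Y) : UnifRel f f
  | trans {X Y : C} {f g h : X ⟶ Y} : UnifRel f g → UnifRel g h → UnifRel f h
  | symm {X Y : C} {f g : X ⟶ Y} : UnifRel f g → UnifRel g f
  | comp {X Y Z : C} {f f' : X ⟶ Y} {g g' : Y ⟶ Z} :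
      UnifRel f f' → UnifRel g g' → UnifRel (f ≫ g) (f' ≫ g')
  | tensor {X Y Z W : C} {f f' : X ⟶ Y} {g g' : Z ⟶ W} :
      UnifRel f f' → UnifRel g g' → UnifRel (f ⊗ₘ g) (f' ⊗ₘ g')
  | ut {S T X Y : C} {u v : S ⟶ T} {f : S ⊗ X ⟶ S ⊗ Y} {g : T ⊗ X ⟶ T ⊗ Y} :
      UnifRel u v → UnifRel (f ≫ u ▷ Y) (v ▷ X ≫ g) →
      UnifRel (TracedCategory.tr S f) (TracedCategory.tr T g)

variable {C : Type u} [Category.{v} C] [MonoidalCategory C] [SymmetricCategory C]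
  [TracedCategory C]

lemma UnifRel.trace (S : C) {X Y : C} {f g : S ⊗ X ⟶ S ⊗ Y} (h : UnifRel f g) :
    UnifRel (TracedCategory.tr S f) (TracedCategory.tr S g) :=
  .ut (.refl (𝟙 S)) (by simpa using h)

lemma UnifRel.map {D : Type*} [Category* D] [MonoidalCategory D] [SymmetricCategory D]
    [TracedCategory D] {F : C ⥤ D} (hF : IsStrictTraced F) {X Y : C} {f g : X ⟶ Y}
    (h : UnifRel f g) : UnifRel (F.map f) (F.map g) := by
  have hl : ∀ {X Y : C} (Z : C) (u : X ⟶ Y), F.map (u ▷ Z) =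
      eqToHom (hF.obj_tensor X Z) ≫ F.map u ▷ F.obj Z ≫ eqToHom (hF.obj_tensor Y Z).symm := by
    intro X Y Z u
    simpa using hF.map_tensor u (𝟙 Z)
  induction h with
  | refl f => exact .refl _
  | symm _ ih => exact .symm ih
  | trans _ _ ih ih' => exact .trans ih ih'
  | comp _ _ ih ih' => rw [F.map_comp, F.map_comp]; exact .comp ih ih'
  | tensor _ _ ih ih' =>
    rw [hF.map_tensor, hF.map_tensor]
    exact .comp (.refl _) (.comp (.tensor ih ih') (.refl _))
  | @ut S T X Y u v f g _ _ ih ih' =>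
    rw [hF.map_tr, hF.map_tr]
    refine .ut ih ?_
    have := UnifRel.comp (.refl (eqToHom (hF.obj_tensor S X).symm))
      (.comp ih' (.refl (eqToHom (hF.obj_tensor T Y))))
    simpa [hl] using this

lemma UnifRel.whiskerLeft (Z : C) {X Y : C} {f g : X ⟶ Y} (h : UnifRel f g) :
    UnifRel (Z ◁ f) (Z ◁ g) := by
  simpa using UnifRel.tensor (.refl (𝟙 Z)) h

lemma UnifRel.whiskerRight (Z : C) {X Y : C} {f g : X ⟶ Y} (h : UnifRel f g) :
    UnifRel (f ▷ Z) (g ▷ Z) := by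
  simpa using UnifRel.tensor h (.refl (𝟙 Z))

/-- `UnifRel` on the morphisms from `X` to `Y`. -/
def unifSetoid (X Y : C) : Setoid (X ⟶ Y) where
  r := UnifRel
  iseqv := ⟨UnifRel.refl, UnifRel.symm, UnifRel.trans⟩

/-- Morphisms of the uniform quotient. -/
def UnifHom (X Y : C) : Type v := Quotient (unifSetoid X Y)

namespace UnifHom

def mk {X Y : C} (f : X ⟶ Y) : UnifHom X Y := Quotient.mk (unifSetoid X Y) f

lemma exists_rep {X Y : C} (f : UnifHom X Y) : ∃ f' : X ⟶ Y, mk f' = f := Quotient.exists_rep f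

lemma sound {X Y : C} {f g : X ⟶ Y} (h : UnifRel f g) : mk f = mk g :=
  Quotient.sound (s := unifSetoid X Y) h

lemma exact {X Y : C} {f g : X ⟶ Y} (h : mk f = mk g) : UnifRel f g :=
  Quotient.exact (s := unifSetoid X Y) h

def comp {X Y Z : C} (f : UnifHom X Y) (g : UnifHom Y Z) : UnifHom X Z :=
  Quotient.map₂ (sa := unifSetoid X Y) (sb := unifSetoid Y Z) (sc := unifSetoid X Z)
    (fun f g => f ≫ g) (fun _ _ h _ _ h' => UnifRel.comp h h') f g

def tensor {X Y Z W : C} (f : UnifHom X Y) (g : UnifHom Z W) : UnifHom (X ⊗ Z) (Y ⊗ W) :=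
  Quotient.map₂ (sa := unifSetoid X Y) (sb := unifSetoid Z W) (sc := unifSetoid _ _)
    (fun f g => f ⊗ₘ g) (fun _ _ h _ _ h' => UnifRel.tensor h h') f g

def whiskerLeft (Z : C) {X Y : C} (f : UnifHom X Y) : UnifHom (Z ⊗ X) (Z ⊗ Y) :=
  Quotient.map (sa := unifSetoid X Y) (sb := unifSetoid _ _)
    (fun f => Z ◁ f) (fun _ _ h => h.whiskerLeft Z) f

def whiskerRight {X Y : C} (f : UnifHom X Y) (Z : C) : UnifHom (X ⊗ Z) (Y ⊗ Z) :=
  Quotient.map (sa := unifSetoid X Y) (sb := unifSetoid _ _)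
    (fun f => f ▷ Z) (fun _ _ h => h.whiskerRight Z) f

def trace (S : C) {X Y : C} (f : UnifHom (S ⊗ X) (S ⊗ Y)) : UnifHom X Y :=
  Quotient.map (sa := unifSetoid _ _) (sb := unifSetoid X Y)
    (fun f => TracedCategory.tr S f) (fun _ _ h => UnifRel.trace S h) f

def map {D : Type*} [Category* D] [MonoidalCategory D] [SymmetricCategory D] [TracedCategory D]
    {F : C ⥤ D} (hF : IsStrictTraced F) {X Y : C} (f : UnifHom X Y) :
    UnifHom (F.obj X) (F.obj Y) :=
  Quotient.map (sa := unifSetoid X Y) (sb := unifSetoid _ _)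
    (fun f => F.map f) (fun _ _ h => UnifRel.map hF h) f

end UnifHom

/-- The quotient of a traced monoidal category by `UnifRel`. It has the same objects as `C` (the
wrapper only keeps the two categories apart). -/
structure Unif (C : Type u) where
  as : C

namespace Unif

open UnifHom (exists_rep)

instance : Category (Unif C) where
  Hom X Y := UnifHom X.as Y.as
  id X := .mk (𝟙 X.as)
  comp f g := UnifHom.comp f g
  id_comp f := by
    obtain ⟨f, rfl⟩ := exists_rep f
    exact congrArg UnifHom.mk (Category.id_comp f)
  comp_id f := by
    obtain ⟨f, rfl⟩ := exists_rep f
    exact congrArg UnifHom.mk (Category.comp_id f)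
  assoc f g h := by
    obtain ⟨f, rfl⟩ := exists_rep f
    obtain ⟨g, rfl⟩ := exists_rep g
    obtain ⟨h, rfl⟩ := exists_rep h
    exact congrArg UnifHom.mk (Category.assoc f g h)

/-- The image in `Unif C` of an isomorphism of `C`. -/
def isoMk {X Y : C} (e : X ≅ Y) : (⟨X⟩ : Unif C) ≅ ⟨Y⟩ where
  hom := UnifHom.mk e.hom
  inv := UnifHom.mk e.inv
  hom_inv_id := congrArg UnifHom.mk e.hom_inv_id
  inv_hom_id := congrArg UnifHom.mk e.inv_hom_id

instance : MonoidalCategoryStruct (Unif C) where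
  tensorObj X Y := ⟨X.as ⊗ Y.as⟩
  tensorUnit := ⟨𝟙_ C⟩
  tensorHom f g := UnifHom.tensor f g
  whiskerLeft X _ _ f := UnifHom.whiskerLeft X.as f
  whiskerRight f Y := UnifHom.whiskerRight f Y.as
  associator X Y Z := isoMk (α_ X.as Y.as Z.as)
  leftUnitor X := isoMk (λ_ X.as)
  rightUnitor X := isoMk (ρ_ X.as)

instance : MonoidalCategory (Unif C) where
  tensorHom_def f g := by
    obtain ⟨f, rfl⟩ := exists_rep f
    obtain ⟨g, rfl⟩ := exists_rep g
    exact congrArg UnifHom.mk (MonoidalCategory.tensorHom_def f g)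
  id_tensorHom_id X Y := congrArg UnifHom.mk (id_tensorHom_id X.as Y.as)
  tensorHom_comp_tensorHom f₁ f₂ g₁ g₂ := by
    obtain ⟨f₁, rfl⟩ := exists_rep f₁
    obtain ⟨f₂, rfl⟩ := exists_rep f₂
    obtain ⟨g₁, rfl⟩ := exists_rep g₁
    obtain ⟨g₂, rfl⟩ := exists_rep g₂
    exact congrArg UnifHom.mk (tensorHom_comp_tensorHom f₁ f₂ g₁ g₂)
  whiskerLeft_id X Y := congrArg UnifHom.mk (whiskerLeft_id X.as Y.as)
  id_whiskerRight X Y := congrArg UnifHom.mk (id_whiskerRight X.as Y.as)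
  associator_naturality f₁ f₂ f₃ := by
    obtain ⟨f₁, rfl⟩ := exists_rep f₁
    obtain ⟨f₂, rfl⟩ := exists_rep f₂
    obtain ⟨f₃, rfl⟩ := exists_rep f₃
    exact congrArg UnifHom.mk (associator_naturality f₁ f₂ f₃)
  leftUnitor_naturality f := by
    obtain ⟨f, rfl⟩ := exists_rep f
    exact congrArg UnifHom.mk (leftUnitor_naturality f)
  rightUnitor_naturality f := by
    obtain ⟨f, rfl⟩ := exists_rep f
    exact congrArg UnifHom.mk (rightUnitor_naturality f)
  pentagon W X Y Z := congrArg UnifHom.mk (pentagon W.as X.as Y.as Z.as)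
  triangle X Y := congrArg UnifHom.mk (triangle X.as Y.as)

instance : BraidedCategory (Unif C) where
  braiding X Y := isoMk (β_ X.as Y.as)
  braiding_naturality_right X _ _ f := by
    obtain ⟨f, rfl⟩ := exists_rep f
    exact congrArg UnifHom.mk (BraidedCategory.braiding_naturality_right X.as f)
  braiding_naturality_left f Z := by
    obtain ⟨f, rfl⟩ := exists_rep f
    exact congrArg UnifHom.mk (BraidedCategory.braiding_naturality_left f Z.as)
  hexagon_forward X Y Z :=
    congrArg UnifHom.mk (BraidedCategory.hexagon_forward X.as Y.as Z.as)
  hexagon_reverse X Y Z :=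
    congrArg UnifHom.mk (BraidedCategory.hexagon_reverse X.as Y.as Z.as)

instance : SymmetricCategory (Unif C) where
  symmetry X Y := congrArg UnifHom.mk (SymmetricCategory.symmetry X.as Y.as)

instance : TracedCategory (Unif C) where
  tr S _ _ f := UnifHom.trace S.as f
  tightening S _ _ _ _ u f v := by
    obtain ⟨u, rfl⟩ := exists_rep u
    obtain ⟨f, rfl⟩ := exists_rep f
    obtain ⟨v, rfl⟩ := exists_rep v
    exact congrArg UnifHom.mk (TracedCategory.tightening S.as u f v)
  strength S _ _ _ _ f g := by
    obtain ⟨f, rfl⟩ := exists_rep f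
    obtain ⟨g, rfl⟩ := exists_rep g
    exact congrArg UnifHom.mk (TracedCategory.strength S.as f g)
  joining S T _ _ f := by
    obtain ⟨f, rfl⟩ := exists_rep f
    exact congrArg UnifHom.mk (TracedCategory.joining S.as T.as f)
  vanishing f := by
    obtain ⟨f, rfl⟩ := exists_rep f
    exact congrArg UnifHom.mk (TracedCategory.vanishing f)
  sliding f u := by
    obtain ⟨f, rfl⟩ := exists_rep f
    obtain ⟨u, rfl⟩ := exists_rep u
    exact congrArg UnifHom.mk (TracedCategory.sliding f u)
  yanking S := congrArg UnifHom.mk (TracedCategory.yanking S.as)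

instance isUniformlyTraced : IsUniformlyTraced (Unif C) where
  uniformity {S T X Y} f g r h := by
    obtain ⟨f, rfl⟩ := exists_rep f
    obtain ⟨g, rfl⟩ := exists_rep g
    obtain ⟨r, rfl⟩ := exists_rep r
    exact UnifHom.sound (.ut (.refl r) (UnifHom.exact h))

lemma mk_eq {X Y : C} (h : X = Y) : Unif.mk X = Unif.mk Y := congrArg _ h

lemma mk_bridge {X Y Z W : C} (h : X = Y) (f : Y ⟶ Z) (h' : Z = W) :
    UnifHom.mk (eqToHom h ≫ f ≫ eqToHom h') =
      eqToHom (mk_eq h) ≫ (show (⟨Y⟩ : Unif C) ⟶ ⟨Z⟩ from UnifHom.mk f) ≫ eqToHom (mk_eq h') := by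
  subst h h'
  simp only [eqToHom_refl, Category.comp_id, Category.id_comp]

lemma isoMk_eqToIso {X Y : C} (h : X = Y) : isoMk (eqToIso h) = eqToIso (mk_eq h) := by
  subst h
  rfl

instance [IsStrictMonoidal C] : IsStrictMonoidal (Unif C) where
  tensor_assoc _ _ _ := mk_eq (IsStrictMonoidal.tensor_assoc _ _ _)
  unit_tensor _ := mk_eq (IsStrictMonoidal.unit_tensor _)
  tensor_unit _ := mk_eq (IsStrictMonoidal.tensor_unit _)
  associator_eq X Y Z :=
    (congrArg isoMk (IsStrictMonoidal.associator_eq X.as Y.as Z.as)).trans (isoMk_eqToIso _)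
  leftUnitor_eq X :=
    (congrArg isoMk (IsStrictMonoidal.leftUnitor_eq X.as)).trans (isoMk_eqToIso _)
  rightUnitor_eq X :=
    (congrArg isoMk (IsStrictMonoidal.rightUnitor_eq X.as)).trans (isoMk_eqToIso _)

variable {D : Type*} [Category* D] [MonoidalCategory D] [SymmetricCategory D] [TracedCategory D]
  {F : C ⥤ D} (hF : IsStrictTraced F)

/-- The functor `[f] ↦ [F f]` induced by a morphism `F` of traced monoidal categories. -/
def map : Unif C ⥤ Unif D where
  obj X := ⟨F.obj X.as⟩
  map f := UnifHom.map hF f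
  map_id X := congrArg UnifHom.mk (F.map_id X.as)
  map_comp f g := by
    obtain ⟨f, rfl⟩ := exists_rep f
    obtain ⟨g, rfl⟩ := exists_rep g
    exact congrArg UnifHom.mk (F.map_comp f g)

lemma isStrictTraced_map : IsStrictTraced (map hF) where
  obj_tensor _ _ := mk_eq (hF.obj_tensor _ _)
  obj_unit := mk_eq hF.obj_unit
  map_tensor f g := by
    obtain ⟨f, rfl⟩ := exists_rep f
    obtain ⟨g, rfl⟩ := exists_rep g
    exact (congrArg UnifHom.mk (hF.map_tensor f g)).trans (mk_bridge _ _ _)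
  map_braiding X Y := (congrArg UnifHom.mk (hF.map_braiding X.as Y.as)).trans (mk_bridge _ _ _)
  map_tr S _ _ f := by
    obtain ⟨f, rfl⟩ := exists_rep f
    exact (congrArg UnifHom.mk (hF.map_tr S.as f)).trans
      (congrArg (UnifHom.trace (F.obj S.as)) (mk_bridge _ _ _))

lemma map_id (C : Type*) [Category* C] [MonoidalCategory C] [SymmetricCategory C]
    [TracedCategory C] : map (isStrictTraced_id C) = 𝟭 (Unif C) :=
  CategoryTheory.Functor.hext (fun _ => rfl) fun X Y f => heq_of_eq <| by
    obtain ⟨f, rfl⟩ := exists_rep f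
    rfl

lemma map_comp {E : Type*} [Category* E] [MonoidalCategory E] [SymmetricCategory E]
    [TracedCategory E] {G : D ⥤ E} (hG : IsStrictTraced G) :
    map (hF.comp hG) = map hF ⋙ map hG :=
  CategoryTheory.Functor.hext (fun _ => rfl) fun X Y f => heq_of_eq <| by
    obtain ⟨f, rfl⟩ := exists_rep f
    rfl

end Unif

end Unif

section Bundled

/-- Small strict symmetric monoidal categories, with strict symmetric monoidal functors. -/
structure SMC : Type (max (u + 1) (v + 1)) where
  carrier : Type u
  [category : Category.{v} carrier]
  [monoidal : MonoidalCategory carrier]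
  [symmetric : SymmetricCategory carrier]
  [strict : IsStrictMonoidal carrier]

attribute [instance] SMC.category SMC.monoidal SMC.symmetric SMC.strict

namespace SMC

/-- Strict symmetric monoidal functors. -/
@[ext]
structure Hom (C D : SMC.{v, u}) where
  functor : C.carrier ⥤ D.carrier
  isStrictSymmetric : IsStrictSymmetric functor

instance : Category SMC.{v, u} where
  Hom := Hom
  id C := ⟨𝟭 C.carrier, isStrictSymmetric_id C.carrier⟩
  comp F G := ⟨F.functor ⋙ G.functor, F.isStrictSymmetric.comp G.isStrictSymmetric⟩

end SMC

/-- Small strict traced symmetric monoidal categories, with trace-preserving strict functors. -/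
structure TSMC : Type (max (u + 1) (v + 1)) where
  carrier : Type u
  [category : Category.{v} carrier]
  [monoidal : MonoidalCategory carrier]
  [symmetric : SymmetricCategory carrier]
  [strict : IsStrictMonoidal carrier]
  [traced : TracedCategory carrier]

attribute [instance] TSMC.category TSMC.monoidal TSMC.symmetric TSMC.strict TSMC.traced

namespace TSMC

/-- Morphisms of traced monoidal categories. -/
@[ext]
structure Hom (C D : TSMC.{v, u}) where
  functor : C.carrier ⥤ D.carrier
  isStrictTraced : IsStrictTraced functor

instance : Category TSMC.{v, u} where
  Hom := Hom
  id C := ⟨𝟭 C.carrier, isStrictTraced_id C.carrier⟩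
  comp F G := ⟨F.functor ⋙ G.functor, F.isStrictTraced.comp G.isStrictTraced⟩

/-- The functor that forgets the trace. -/
def forget : TSMC.{v, u} ⥤ SMC.{v, u} where
  obj C := ⟨C.carrier⟩
  map F := ⟨F.functor, F.isStrictTraced.toIsStrictSymmetric⟩

/-- The property of being uniformly traced. -/
def isUniformlyTraced : ObjectProperty TSMC.{v, u} := fun C => IsUniformlyTraced C.carrier

end TSMC

/-- Uniformly traced monoidal categories, with the morphisms of traced monoidal categories. -/
abbrev UTSMC : Type (max (u + 1) (v + 1)) := TSMC.isUniformlyTraced.{v, u}.FullSubcategory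

/-- The functor that forgets the (uniform) trace. -/
def UTSMC.forget : UTSMC.{v, u} ⥤ SMC.{v, u} := TSMC.isUniformlyTraced.ι ⋙ TSMC.forget

/-- The functor `freeTr` from symmetric monoidal to traced monoidal categories. -/
def freeTr : SMC.{max u v, u} ⥤ TSMC.{max u v, u} where
  obj C := ⟨FreeTr C.carrier⟩
  map F := ⟨FreeTr.map F.isStrictSymmetric, FreeTr.isStrictTraced_map F.isStrictSymmetric⟩
  map_id C := TSMC.Hom.ext (FreeTr.map_id C.carrier)
  map_comp F G := TSMC.Hom.ext (FreeTr.map_comp F.isStrictSymmetric G.isStrictSymmetric)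

/-- The functor `Unif` from traced monoidal to uniformly traced monoidal categories. -/
def unif : TSMC.{v, u} ⥤ UTSMC.{v, u} where
  obj C := ⟨⟨Unif C.carrier⟩, Unif.isUniformlyTraced⟩
  map F := ⟨⟨Unif.map F.isStrictTraced, Unif.isStrictTraced_map F.isStrictTraced⟩⟩
  map_id C := ObjectProperty.hom_ext _ (TSMC.Hom.ext (Unif.map_id C.carrier))
  map_comp F G := ObjectProperty.hom_ext _
    (TSMC.Hom.ext (Unif.map_comp F.isStrictTraced G.isStrictTraced))

/-- The functor `UTr = Unif ∘ freeTr`. A pair `(f | S)` involves an object and a morphism, so the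
morphisms of `C` are taken in a universe at least as large as that of its objects. -/
def UTr : SMC.{max u v, u} ⥤ UTSMC.{max u v, u} := freeTr.{v, u} ⋙ unif

end Bundled

end UniformTrace

namespace UniformTrace

/-! The forgetful functor drops uniformity first and then the trace, so the theorem splits into two
adjunctions that compose: `freeTrAdjunction` for the trace and `unifAdjunction` for uniformity.

For the trace, a formal pair `(f | S)` over a category that already has a trace can be evaluated to
the actual morphism `tr_S f`. This is well defined because every generator and every closure rule of
`StRel` mirrors a property of a trace: sliding and yanking are axioms, formal composites and tensors
evaluate to composites and tensors by tightening, strength and joining (`tr_compRaw`,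
`tr_tensorRaw`), and formal traces evaluate to traces by joining (`tr_tRaw`). All of this is
collected in `StRel.tr_eq`. Evaluation is the counit, and `f ↦ (f | I)` is the unit. One triangle
identity is `tr_I (id_I ⊗ f) = f`, that is, vanishing. The other is `(f | S) = tr_S (f | I)`, which
is `TrHom.trace_incl`; it says that the free traced category is generated by `C` under traces.

For uniformity, `≈` is the least congruence closed under the uniformity rule, and equality in a
uniformly traced category is itself such a congruence. Hence `≈` is equality there (`UnifRel.eq`)
and each class has a single member. The unit is the quotient functor and the counit sends a class to
that member; on representatives both triangle identities hold by definition. -/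

/-- The functors constructed below preserve `⊗` and the unit definitionally, so the `eqToHom` in the
strictness conditions go from an object to itself; this removes them. -/
lemma eqToHom_conj {C : Type u} [Category.{v} C] {X Y : C} (h : X = X) (h' : Y = Y) (f : X ⟶ Y) :
    eqToHom h ≫ f ≫ eqToHom h' = f := by
  simp

/-! ### Evaluation of formal pairs in a traced category -/

section Eval

variable {C : Type u} [Category.{v} C] [MonoidalCategory C] [SymmetricCategory C]
  [TracedCategory C]

open TracedCategory

lemma tr_comp_whiskerLeft (S : C) {X Y Y' : C} (f : S ⊗ X ⟶ S ⊗ Y) (v : Y ⟶ Y') :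
    tr S (f ≫ S ◁ v) = tr S f ≫ v := by
  simpa using tightening S (𝟙 X) f v

lemma tr_whiskerLeft_comp (S : C) {X X' Y : C} (u : X' ⟶ X) (f : S ⊗ X ⟶ S ⊗ Y) :
    tr S (S ◁ u ≫ f) = u ≫ tr S f := by
  simpa using tightening S u f (𝟙 Y)

lemma tr_wr {S X Y : C} (f : S ⊗ X ⟶ S ⊗ Y) (Z : C) : tr S (wr f Z) = tr S f ▷ Z := by
  simpa [wr] using strength S f (𝟙 Z)

/-- Strength speaks only of tensoring on the right. By `wl_braid`, the symmetry turns `wl Z f` into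
`wr f Z`; tightening takes the symmetries out of the trace, naturality moves one past `tr S f`, and
it is then cancelled as an isomorphism. -/
lemma tr_wl (Z : C) {S X Y : C} (f : S ⊗ X ⟶ S ⊗ Y) : tr S (wl Z f) = Z ◁ tr S f := by
  have h := congrArg (tr S) (wl_braid Z f)
  rw [tr_comp_whiskerLeft, tr_whiskerLeft_comp, tr_wr,
    ← BraidedCategory.braiding_naturality_right, cancel_mono] at h
  exact h

lemma tr_tRaw {S T X Y : C} (f : S ⊗ (T ⊗ X) ⟶ S ⊗ (T ⊗ Y)) :
    tr (S ⊗ T) (tRaw f) = tr T (tr S f) :=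
  (joining S T f).symm

/-- Joining allows the two state wires to be closed one after the other. Closing `S` reduces `wl T
f` to `T ◁ tr S f` and lets `g` out by tightening; closing `T` then lets `tr S f` out. -/
lemma tr_compRaw {S T X Y Z : C} (f : S ⊗ X ⟶ S ⊗ Y) (g : T ⊗ Y ⟶ T ⊗ Z) :
    tr (S ⊗ T) (compRaw f g) = tr S f ≫ tr T g := by
  rw [compRaw_eq, tr_tRaw, tr_comp_whiskerLeft, tr_wl, tr_whiskerLeft_comp]

/-- The formal tensor is the formal composite of the two whiskerings, so the previous case applies.
-/
lemma tr_tensorRaw {S T X Y Z W : C} (f : S ⊗ X ⟶ S ⊗ Y) (g : T ⊗ Z ⟶ T ⊗ W) :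
    tr (S ⊗ T) (tensorRaw f g) = tr S f ⊗ₘ tr T g := by
  rw [tensorRaw_eq, tr_compRaw, tr_wr, tr_wl, MonoidalCategory.tensorHom_def]

/-- Vanishing leaves a conjugate by left unitors, which cancel by naturality. This is what makes the
evaluation of `(f | I)` return `f`. -/
lemma tr_unit_whiskerLeft {X Y : C} (f : X ⟶ Y) : tr (𝟙_ C) (𝟙_ C ◁ f) = f := by
  simp [vanishing]

/-- Since `StRel` is the least congruence containing sliding and yanking, it suffices that having
equal traces is such a congruence. Closure under the three operations holds because the trace of
each result depends only on the traces of its arguments. -/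
lemma StRel.tr_eq {X Y : C} {f g : StHom X Y} (h : StRel f g) : tr f.st f.hom = tr g.st g.hom := by
  induction h with
  | refl _ => rfl
  | symm _ ih => exact ih.symm
  | trans _ _ ih ih' => exact ih.trans ih'
  | sliding f u => exact TracedCategory.sliding f u
  -- The identity of `𝟙_ C ⊗ S` on the right is viewed as the whiskered identity of `S`, so that its
  -- trace over the unit is the identity of `S`.
  | yanking S => rw [TracedCategory.yanking, ← whiskerLeft_id, tr_unit_whiskerLeft]
  | comp _ _ ih ih' => rw [tr_compRaw, tr_compRaw, ih, ih']
  | tensor _ _ ih ih' => rw [tr_tensorRaw, tr_tensorRaw, ih, ih']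
  | trace T _ ih => rw [tr_tRaw, tr_tRaw, ih]

/-- The value `tr_S f` of the class of a pair `(f | S)` in a traced category. -/
def TrHom.eval {X Y : C} (f : TrHom X Y) : X ⟶ Y :=
  Quotient.lift (fun f : StHom X Y => tr f.st f.hom) (fun _ _ h => StRel.tr_eq h) f

lemma TrHom.eval_incl {X Y : C} (f : X ⟶ Y) : (TrHom.incl f).eval = f := tr_unit_whiskerLeft f

namespace FreeTr

/-- The functor `(f | S) ↦ tr_S f`. -/
def eval (C : Type u) [Category.{v} C] [MonoidalCategory C] [SymmetricCategory C]
    [TracedCategory C] : FreeTr C ⥤ C where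
  obj X := X.as
  map f := TrHom.eval f
  map_id X :=
    Eq.trans (congrArg TrHom.eval (TrHom.incl_id X.as).symm) (TrHom.eval_incl _)
  map_comp f g := by
    obtain ⟨S, f, rfl⟩ := TrHom.exists_rep f
    obtain ⟨T, g, rfl⟩ := TrHom.exists_rep g
    exact tr_compRaw f g

/-- Preservation of traces is joining: the formal trace along `T` only enlarges the state from `S`
to `S ⊗ T`, and evaluating closes both wires. -/
lemma isStrictTraced_eval : IsStrictTraced (eval C) where
  obj_tensor _ _ := rfl
  obj_unit := rfl
  map_tensor f g := by
    obtain ⟨S, f, rfl⟩ := TrHom.exists_rep f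
    obtain ⟨T, g, rfl⟩ := TrHom.exists_rep g
    exact (tr_tensorRaw f g).trans (eqToHom_conj _ _ _).symm
  map_braiding X Y :=
    (TrHom.eval_incl (β_ X.as Y.as).hom).trans (eqToHom_conj _ _ _).symm
  map_tr T X Y f := by
    obtain ⟨S, f, rfl⟩ := TrHom.exists_rep f
    exact (tr_tRaw f).trans (congrArg (TracedCategory.tr _) (eqToHom_conj _ _ _).symm)

end FreeTr

end Eval

/-! ### The inclusion of a symmetric monoidal category in its free traced category -/

section Inclusion

variable (C : Type u) [Category.{v} C] [MonoidalCategory C] [SymmetricCategory C]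

/-- The functor `f ↦ (f | I)`. -/
def FreeTr.inclusion : C ⥤ FreeTr C where
  obj X := ⟨X⟩
  map f := TrHom.incl f
  map_id X := TrHom.incl_id X
  map_comp f g := (TrHom.incl_comp_incl f g).symm

lemma FreeTr.isStrictSymmetric_inclusion : IsStrictSymmetric (FreeTr.inclusion C) where
  obj_tensor _ _ := rfl
  obj_unit := rfl
  map_tensor f g :=
    (TrHom.incl_tensor_incl f g).symm.trans (eqToHom_conj (C := FreeTr C) rfl rfl _).symm
  map_braiding _ _ :=
    (eqToHom_conj _ _ _).symm

variable {C}

/-- The formal trace of `(f | I)` has state `I ⊗ S`, which the left unitor identifies with `S`.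
Every morphism of the free category is thus a trace of one coming from `C`, so a traced functor is
determined by its restriction to `C`; this gives a triangle identity of the adjunction. -/
lemma TrHom.trace_incl {S X Y : C} (f : S ⊗ X ⟶ S ⊗ Y) :
    TrHom.trace S (TrHom.incl f) = TrHom.mk S f := by
  rw [TrHom.incl, TrHom.trace_mk]
  refine TrHom.mk_iso (λ_ S) ?_
  simp [tRaw]

end Inclusion

/-! ### The uniform quotient, and its triviality on uniformly traced categories -/

section Quotient

variable (C : Type u) [Category.{v} C] [MonoidalCategory C] [SymmetricCategory C]
  [TracedCategory C]

/-- The quotient functor `f ↦ [f]`. -/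
def Unif.quotient : C ⥤ Unif C where
  obj X := ⟨X⟩
  map f := UnifHom.mk f

lemma Unif.isStrictTraced_quotient : IsStrictTraced (Unif.quotient C) where
  obj_tensor _ _ := rfl
  obj_unit := rfl
  map_tensor _ _ :=
    (eqToHom_conj _ _ _).symm
  map_braiding _ _ :=
    (eqToHom_conj _ _ _).symm
  map_tr S _ _ f :=
    congrArg (TracedCategory.tr (⟨S⟩ : Unif C))
      (eqToHom_conj (C := Unif C) rfl rfl (UnifHom.mk f)).symm

variable {C} [IsUniformlyTraced C]

/-- Equality satisfies all the closure rules that define `UnifRel`. Only `ut` needs an argument: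
once `u ≈ v` is known to mean `u = v`, the rule is the uniformity axiom with `r = u`. -/
lemma UnifRel.eq {X Y : C} {f g : X ⟶ Y} (h : UnifRel f g) : f = g := by
  induction h with
  | refl _ => rfl
  | symm _ ih => exact ih.symm
  | trans _ _ ih ih' => exact ih.trans ih'
  | comp _ _ ih ih' => rw [ih, ih']
  | tensor _ _ ih ih' => rw [ih, ih']
  | ut _ _ ih ih' =>
    subst ih
    exact IsUniformlyTraced.uniformity _ _ _ ih'

/-- The representative of a class, in a category that is already uniformly traced. -/
def UnifHom.out {X Y : C} (f : UnifHom X Y) : X ⟶ Y :=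
  Quotient.lift (s := unifSetoid X Y) (fun f => f) (fun _ _ h => UnifRel.eq h) f

variable (C)

/-- The functor `[f] ↦ f` on the uniform quotient of a uniformly traced category. -/
def Unif.out : Unif C ⥤ C where
  obj X := X.as
  map f := UnifHom.out f
  map_id _ := rfl
  map_comp f g := by
    obtain ⟨f, rfl⟩ := UnifHom.exists_rep f
    obtain ⟨g, rfl⟩ := UnifHom.exists_rep g
    rfl

/-- The operations of `Unif C` are defined on representatives, so on a class `[f]` each condition
reduces by computation to an identity in `C`. -/
lemma Unif.isStrictTraced_out : IsStrictTraced (Unif.out C) where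
  obj_tensor _ _ := rfl
  obj_unit := rfl
  map_tensor f g := by
    obtain ⟨f, rfl⟩ := UnifHom.exists_rep f
    obtain ⟨g, rfl⟩ := UnifHom.exists_rep g
    exact (eqToHom_conj _ _ _).symm
  map_braiding _ _ :=
    (eqToHom_conj _ _ _).symm
  map_tr S X Y f := by
    obtain ⟨f, rfl⟩ := UnifHom.exists_rep f
    exact (congrArg (TracedCategory.tr _) (eqToHom_conj _ _ _).symm)

end Quotient

/-! ### The two adjunctions and their composite -/

/-- `freeTr` is left adjoint to the functor that forgets the trace. -/
def freeTrAdjunction : freeTr.{v, u} ⊣ TSMC.forget.{max u v, u} where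
  unit :=
    { app C := ⟨FreeTr.inclusion C.carrier, FreeTr.isStrictSymmetric_inclusion C.carrier⟩
      naturality C D F := SMC.Hom.ext <|
        CategoryTheory.Functor.hext (fun _ => rfl) fun X Y f => heq_of_eq
          (TrHom.map_incl F.isStrictSymmetric f).symm }
  counit :=
    { app D := ⟨FreeTr.eval D.carrier, FreeTr.isStrictTraced_eval⟩
      naturality C D F := TSMC.Hom.ext <|
        CategoryTheory.Functor.hext (fun _ => rfl) fun X Y f => heq_of_eq <| by
          obtain ⟨S, f, rfl⟩ := TrHom.exists_rep f
          -- On `(f | S)` the two sides are the trace of `F f` along `F S` and the image under `F`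
          -- of `tr_S f`, so naturality of evaluation is preservation of traces.
          exact (F.isStrictTraced.map_tr S f).symm }
  left_triangle_components C := TSMC.Hom.ext <|
    CategoryTheory.Functor.hext (fun _ => rfl) fun X Y f => heq_of_eq <| by
      obtain ⟨S, f, rfl⟩ := TrHom.exists_rep f
      -- Applying `freeTr` to the unit turns `(f | S)` into a pair whose morphism is `(f | I)`, and
      -- the counit takes its trace in `FreeTr C`. The remaining goal discards the two identities
      -- that `mapRaw` puts around `(f | I)`.
      refine Eq.trans (congrArg (TracedCategory.tr (⟨S⟩ : FreeTr C.carrier)) ?_)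
        (TrHom.trace_incl f)
      exact (Category.id_comp _).trans (Category.comp_id _)
  right_triangle_components D := SMC.Hom.ext <|
    CategoryTheory.Functor.hext (fun _ => rfl) fun X Y f => heq_of_eq
      (TrHom.eval_incl (C := D.carrier) f)

/-- `Unif` is left adjoint to the inclusion of the uniformly traced categories. -/
def unifAdjunction : unif.{v, u} ⊣ TSMC.isUniformlyTraced.{v, u}.ι where
  unit :=
    { app C := ⟨Unif.quotient C.carrier, Unif.isStrictTraced_quotient C.carrier⟩
      naturality C D F := rfl }
  counit :=
    { app D :=
        -- Membership in the full subcategory supplies the uniformity that makes `UnifHom.out` well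
        -- defined.
        have : IsUniformlyTraced D.obj.carrier := D.property
        ⟨⟨Unif.out D.obj.carrier, Unif.isStrictTraced_out D.obj.carrier⟩⟩
      naturality C D F := ObjectProperty.hom_ext _ <| TSMC.Hom.ext <|
        CategoryTheory.Functor.hext (fun _ => rfl) fun X Y f => heq_of_eq <| by
          obtain ⟨f, rfl⟩ := UnifHom.exists_rep f
          rfl }
  left_triangle_components C := ObjectProperty.hom_ext _ <| TSMC.Hom.ext <|
    CategoryTheory.Functor.hext (fun _ => rfl) fun X Y f => heq_of_eq <| by
      obtain ⟨f, rfl⟩ := UnifHom.exists_rep f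
      rfl
  right_triangle_components D := rfl

end UniformTrace

theorem mainTheorem1 :
  Nonempty (UniformTrace.UTr.{v, u} ⊣ UniformTrace.UTSMC.forget.{max u v, u}) :=
  -- `UTr` and `UTSMC.forget` are by definition the composites of the left and of the right
  -- adjoints.
  ⟨UniformTrace.freeTrAdjunction.comp UniformTrace.unifAdjunction⟩
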